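/- Let $m,K,N$ be integers with $m\ge 1$ and $N\ge K>2m$, and let $\mu>0$, $\rho>0$. Write $x=(y,z)\in\mathbb{R}^K\times\mathbb{R}^{N-K}=\mathbb{R}^N$, put $2_*:=2+\frac{4m}{N}$, $2^*:=\frac{2N}{N-2m}$, and let $\nabla^m:=\Delta^{m/2}$ if $m$ is even, $\nabla^m:=\nabla\Delta^{(m-1)/2}$ if $m$ is odd. For $f_1,f_2:\mathbb{R}\to\mathbb{R}$ write $f_1\preceq f_2$ if $f_1(s)\le f_2(s)$ for all $s$ and for every $\gamma>0$ there is $|s|<\gamma$ with $f_1(s)<f_2(s)$. For a continuous $g:\mathbb{R}\to\mathbb{R}$ let $G(s):=\int_0^s g(t)\,dt$ and $H(s):=g(s)s-2G(s)$, and assume: - (A0) $H$ is differentiable, $h:=H'$ is continuous, and there is $C>0$ with $|g(s)|+|h(s)|\le C(|s|+|s|^{2^*-1})$ for all $s\in\mathbb{R}$; - (A1) $\eta:=\limsup_{|s|\to0}H(s)/|s|^{2_*}<+\infty$; - (A2) $\lim_{|s|\to+\infty}G(s)/|s|^{2_*}=+\infty$; - (A3) $\lim_{|s|\to+\infty}G(s)/|s|^{2^*}=0$;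 - (A4) $2_*H(s)\preceq h(s)s$; - (A5) $0\preceq\frac{4m}{N}G$, $\frac{4m}{N}G(s)\le H(s)$ for all $s\in\mathbb{R}$, and $H\preceq(2^*-2)G$. Let $C_*$ be the optimal constant in the Gagliardo–Nirenberg inequality $|u|_{2_*}\le C_*\,|\nabla^m u|_2^{\delta}\,|u|_2^{1-\delta}$ for $u\in H^m(\mathbb{R}^N)$, where $|\cdot|_p$ is the norm of $L^p(\mathbb{R}^N)$ and $\delta:=\frac{N}{m}\left(\frac12-\frac1{2_*}\right)$, and assume $$\frac{N}{2m}\,\eta\,C_*^{2_*}\,\rho^{\frac{2m}{N}}<1.$$ Define $$J(u):=\frac12\int_{\mathbb{R}^N}|\nabla^m u|^2+\frac{\mu}{|y|^{2m}}u^2\,dx-\int_{\mathbb{R}^N}G(u)\,dx,$$ $$\mathcal{M}_\mu:=\left\{u\in H^m(\mathbb{R}^N)\setminus\{0\}:\ \int_{\mathbb{R}^N}|\nabla^m u|^2+\frac{\mu}{|y|^{2m}}u^2\,dx=\frac{N}{2m}\int_{\mathbb{R}^N}H(u)\,dx\right\},$$ $$\mathcal{D}:=\left\{u\in L^2(\mathbb{R}^N):\int_{\mathbb{R}^N}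 u^2\,dx\le\rho\right\},\qquad \mathcal{S}:=\left\{u\in L^2(\mathbb{R}^N):\int_{\mathbb{R}^N} u^2\,dx=\rho\right\}.$$ Then $J$ has no minimizer on $\mathcal{M}_\mu\cap\mathcal{D}$ and no minimizer on $\mathcal{M}_\mu\cap\mathcal{S}$. In particular the problem $$(-\Delta)^m u+\frac{\mu}{|y|^{2m}}u+\lambda u=g(u)\ \text{ in }\mathbb{R}^N,\qquad \int_{\mathbb{R}^N}u^2\,dx=\rho$$ has no normalized ground state solution in $H^m(\mathbb{R}^N)$, i.e. there is no $u\in\mathcal{M}_\mu\cap\mathcal{S}$ which is a weak solution of the equation for some $\lambda\in\mathbb{R}$ and satisfies $J(u)=\inf_{\mathcal{M}_\mu\cap\mathcal{S}}J$. -/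

import Mathlib

open MeasureTheory Filter Topology
open scoped ContDiff ENNReal

noncomputable section

namespace Polyharmonic

/-- The Euclidean space `ℝ^N`. -/
abbrev Space (N : ℕ) : Type := EuclideanSpace ℝ (Fin N)

/-- `φ` is a test function, i.e. `φ ∈ C_c^∞(ℝ^N)`. -/
def IsTest {N : ℕ} (φ : Space N → ℝ) : Prop :=
  ContDiff ℝ ∞ φ ∧ HasCompactSupport φ

/-- The classical partial derivative `∂_i φ`. -/
def partialDeriv {N : ℕ} (i : Fin N) (φ : Space N → ℝ) (x : Space N) : ℝ :=
  fderiv ℝ φ x (EuclideanSpace.single i 1)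

/-- `v` is the weak (distributional) partial derivative `∂_i u`. -/
def HasWeakPartial {N : ℕ} (i : Fin N) (u v : Space N → ℝ) : Prop :=
  LocallyIntegrable u ∧ LocallyIntegrable v ∧
    ∀ φ : Space N → ℝ, IsTest φ →
      ∫ x, u x * partialDeriv i φ x = - ∫ x, v x * φ x

/-- `u ∈ H^k(ℝ^N)`: `u` and all its weak partial derivatives of order at most `k` lie in
`L^2(ℝ^N)`. Stated by recursion on the order: `u ∈ H^{k+1}` iff `u ∈ L^2` and each weak partial
derivative of `u` exists and belongs to `H^k`. -/
def MemH {N : ℕ} : ℕ → (Space N → ℝ) → Prop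
  | 0, u => MemLp u 2 volume
  | k + 1, u => MemLp u 2 volume ∧ ∀ i : Fin N, ∃ v, HasWeakPartial i u v ∧ MemH k v

open Classical in
/-- A representative of the weak partial derivative `∂_i u` (unique up to null sets),
and `0` if there is none. -/
def weakPartial {N : ℕ} (i : Fin N) (u : Space N → ℝ) : Space N → ℝ :=
  if h : ∃ v, HasWeakPartial i u v then h.choose else 0

/-- The weak Laplacian `Δu = ∑ᵢ ∂_i ∂_i u`. -/
def weakLaplacian {N : ℕ} (u : Space N → ℝ) (x : Space N) : ℝ :=
  ∑ i : Fin N, weakPartial i (weakPartial i u) x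

/-- The pointwise product `∇^m u · ∇^m v`, where `∇^m = Δ^{m/2}` if `m` is even and
`∇^m = ∇Δ^{(m-1)/2}` if `m` is odd (note that `m / 2 = (m - 1) / 2` in `ℕ` for odd `m`). -/
def polyGradMul {N : ℕ} (m : ℕ) (u v : Space N → ℝ) (x : Space N) : ℝ :=
  if Even m then (weakLaplacian^[m / 2] u) x * (weakLaplacian^[m / 2] v) x
  else ∑ i : Fin N,
    weakPartial i (weakLaplacian^[m / 2] u) x * weakPartial i (weakLaplacian^[m / 2] v) x

/-- `|∇^m u|^2` as a function on `ℝ^N`. -/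
def polyGradSq {N : ℕ} (m : ℕ) (u : Space N → ℝ) (x : Space N) : ℝ := polyGradMul m u u x

/-- `|y|`, where `x = (y, z) ∈ ℝ^K × ℝ^{N-K}`, i.e. `y` consists of the first `K` coordinates. -/
def yNorm {N : ℕ} (K : ℕ) (x : Space N) : ℝ :=
  Real.sqrt (∑ i : Fin N with i.val < K, x i ^ 2)

/-- The exponent `2_* = 2 + 4m/N`. -/
def massExp (N m : ℕ) : ℝ := 2 + 4 * m / N

/-- The exponent `2^* = 2N/(N-2m)`, for `N > 2m`. -/
def sobolevExp (N m : ℕ) : ℝ := 2 * N / (N - 2 * m)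

/-- The primitive `G(s) = ∫_0^s g`. -/
def Gfun (g : ℝ → ℝ) (s : ℝ) : ℝ := ∫ t in (0 : ℝ)..s, g t

/-- `H(s) = g(s)s - 2G(s)`. -/
def Hfun (g : ℝ → ℝ) (s : ℝ) : ℝ := g s * s - 2 * Gfun g s

/-- The relation `f₁ ⪯ f₂`: `f₁ ≤ f₂` everywhere and `f₁ < f₂` at points arbitrarily close to
the origin. -/
def Prec (f₁ f₂ : ℝ → ℝ) : Prop :=
  (∀ s, f₁ s ≤ f₂ s) ∧ ∀ γ > 0, ∃ s, |s| < γ ∧ f₁ s < f₂ s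

/-- `limsup_{|s| → 0} H(s)/|s|^{2_*}`, as an extended real number. -/
def etaExt (N m : ℕ) (g : ℝ → ℝ) : EReal :=
  limsup (fun s : ℝ => ((Hfun g s / |s| ^ massExp N m : ℝ) : EReal)) (𝓝[≠] 0)

/-- `η`; the conditions on `g` below make `etaExt` a finite nonnegative number. -/
def eta (N m : ℕ) (g : ℝ → ℝ) : ℝ := (etaExt N m g).toReal

/-- The structural conditions on the nonlinearity `g`, in dimension `N > 2m`. -/
structure Admissible (N m : ℕ) (g : ℝ → ℝ) : Prop where
  /-- `g` is continuous, -/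
  cont : Continuous g
  /-- `H` is differentiable with continuous derivative `h = H'`, -/
  diff_H : Differentiable ℝ (Hfun g)
  cont_h : Continuous (deriv (Hfun g))
  /-- `|g(s)| + |h(s)| ≲ |s| + |s|^{2^*-1}`, -/
  growth : ∃ C : ℝ, ∀ s, |g s| + |deriv (Hfun g) s| ≤ C * (|s| + |s| ^ (sobolevExp N m - 1))
  /-- `η < +∞`, -/
  eta_lt_top : etaExt N m g < ⊤
  /-- `G(s)/|s|^{2_*} → +∞` as `|s| → +∞`, -/
  mass_super : Tendsto (fun s : ℝ => Gfun g s / |s| ^ massExp N m) (cocompact ℝ) atTop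
  /-- `G(s)/|s|^{2^*} → 0` as `|s| → +∞`, -/
  sobolev_sub : Tendsto (fun s : ℝ => Gfun g s / |s| ^ sobolevExp N m) (cocompact ℝ) (𝓝 0)
  /-- `2_* H(s) ⪯ h(s)s`, -/
  prec_h : Prec (fun s => massExp N m * Hfun g s) (fun s => deriv (Hfun g) s * s)
  /-- `0 ⪯ (4m/N) G(s) ≤ H(s) ⪯ (2^*-2) G(s)`. -/
  G_pos : Prec (fun _ => 0) (fun s => 4 * m / N * Gfun g s)
  G_le_H : ∀ s, 4 * m / N * Gfun g s ≤ Hfun g s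
  H_prec : Prec (Hfun g) (fun s => (sobolevExp N m - 2) * Gfun g s)

/-- The optimal constant `C_{N,p}` in the Gagliardo–Nirenberg inequality
`|u|_p ≤ C |∇^m u|_2^δ |u|_2^{1-δ}` on `H^m(ℝ^N)`, where `δ = (N/m)(1/2 - 1/p)`. -/
def gnConst (N m : ℕ) (p : ℝ) : ℝ :=
  sInf {C : ℝ | 0 ≤ C ∧ ∀ u : Space N → ℝ, MemH m u →
    eLpNorm u (ENNReal.ofReal p) volume ≤ ENNReal.ofReal
      (C * Real.sqrt (∫ x, polyGradSq m u x) ^ ((N : ℝ) / m * (1 / 2 - 1 / p))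
        * Real.sqrt (∫ x, u x ^ 2) ^ (1 - (N : ℝ) / m * (1 / 2 - 1 / p)))}

/-- `[u]_μ^2 = ∫ |∇^m u|^2 + μ |y|^{-2m} u^2`. -/
def singularForm {N : ℕ} (K m : ℕ) (μ : ℝ) (u : Space N → ℝ) : ℝ :=
  ∫ x, (polyGradSq m u x + μ / yNorm K x ^ (2 * m) * u x ^ 2)

/-- The energy `J`. -/
def energy {N : ℕ} (K m : ℕ) (μ : ℝ) (g : ℝ → ℝ) (u : Space N → ℝ) : ℝ :=
  1 / 2 * singularForm K m μ u - ∫ x, Gfun g (u x)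

/-- The constraint `u ∈ H^m(ℝ^N) ∖ {0}`, `[u]_μ^2 = (N/2m) ∫ H(u)` (no symmetry imposed). -/
def pohozaevSet (N K m : ℕ) (μ : ℝ) (g : ℝ → ℝ) : Set (Space N → ℝ) :=
  {u | MemH m u ∧ ¬ (u =ᵐ[volume] 0) ∧
    singularForm K m μ u = (N : ℝ) / (2 * m) * ∫ x, Hfun g (u x)}

/-- The ball `𝒟` of radius `√ρ` in `L^2(ℝ^N)`. -/
def massBall (N : ℕ) (ρ : ℝ) : Set (Space N → ℝ) :=
  {u | MemLp u 2 volume ∧ ∫ x, u x ^ 2 ≤ ρ}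

/-- The sphere `𝒮` of radius `√ρ` in `L^2(ℝ^N)`. -/
def massSphere (N : ℕ) (ρ : ℝ) : Set (Space N → ℝ) :=
  {u | MemLp u 2 volume ∧ ∫ x, u x ^ 2 = ρ}

/-- `u` minimizes `F` over `A`; in particular `u ∈ A`. -/
def IsMinimizer {α : Type*} (F : α → ℝ) (A : Set α) (u : α) : Prop :=
  u ∈ A ∧ ∀ v ∈ A, F u ≤ F v

/-- `u ∈ H^m(ℝ^N)` is a weak solution of `(-Δ)^m u + μ |y|^{-2m} u + lam u = g(u)`. -/
def IsWeakSolution {N : ℕ} (K m : ℕ) (μ lam : ℝ) (g : ℝ → ℝ) (u : Space N → ℝ) : Prop :=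
  MemH m u ∧ ∀ φ : Space N → ℝ, IsTest φ →
    ∫ x, (polyGradMul m u φ x + μ / yNorm K x ^ (2 * m) * u x * φ x + lam * u x * φ x)
      = ∫ x, g (u x) * φ x

/-- `u` is a normalized ground state solution in `H^m(ℝ^N)`: it has mass `ρ`, solves the
equation weakly for some `lam ∈ ℝ`, and attains the infimum of the energy over the functions of
mass `ρ` in the Pohožaev-type constraint. -/
def IsNormalizedGroundState {N : ℕ} (K m : ℕ) (μ ρ : ℝ) (g : ℝ → ℝ) (u : Space N → ℝ) : Prop :=
  (∃ lam : ℝ, IsWeakSolution K m μ lam g u) ∧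
    IsMinimizer (energy K m μ g) (pohozaevSet N K m μ g ∩ massSphere N ρ) u

end Polyharmonic

end

noncomputable section

namespace Polyharmonic

section

/-! ### Weak derivatives -/

variable {N : ℕ}

/-! The singular potential decays away from y = 0, so it pays to move a function off in the
y-directions, and this never stops paying. Given u in the constraint with mass at most ρ, write a
for the integral of |∇^m u|² and b > 0 for that of |y|^{-2m}u². A translation replaces b by some b'
< b and leaves every other integral unchanged. The translate has left the constraint: its quadratic
form is now too small for its nonlinear term. A mass-preserving dilation w(x) = r u(sx + τ), with
s^N = r² and r ≤ 1, brings it back, and J(w) < J(u). Hence no u can minimize, on the ball or on the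
sphere.

Such an r exists by the intermediate value theorem for r ↦ r^{-2_*}∫H(ru), which has to reach
(2m/N)(a + μb'). At r = 1 it is above this value, because b' < b. For small r it is below: near the
origin H is at most (η+ε)|·|^{2_*}, and Gagliardo–Nirenberg with the smallness condition gives
η∫|u|^{2_*} ≤ (2m/N)a (`Admissible.exists_scaled_integral_eq`). The energies are compared through
G(t) - r^{-2}G(rt) ≤ (N/4m)(1 - r^{4m/N})H(t), a consequence of (A4) (`Admissible.gfun_sub_le`).

Three analytic facts carry this. `MemH.integrable_hardy` shows that b is finite on H^m.
`exists_translate_lt` finds the translation by averaging over a large ball of shifts.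
`MemH.gagliardoNirenberg` makes the optimal constant usable, which requires proving that some
constant works. The Fourier transform serves both the last fact and the smooth approximation behind
the Hardy bound. -/

theorem IsTest.continuous {φ : Space N → ℝ} (h : IsTest φ) : Continuous φ := h.1.continuous

theorem IsTest.continuous_partialDeriv {φ : Space N → ℝ} (h : IsTest φ) (i : Fin N) :
    Continuous (partialDeriv i φ) :=
  (h.1.continuous_fderiv (by simp)).clm_apply continuous_const

theorem IsTest.hasCompactSupport_partialDeriv {φ : Space N → ℝ} (h : IsTest φ) (i : Fin N) :
    HasCompactSupport (partialDeriv i φ) :=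
  h.2.fderiv_apply ℝ _

theorem _root_.MeasureTheory.LocallyIntegrable.integrable_mul_of_hasCompactSupport
    {u φ : Space N → ℝ} (hu : LocallyIntegrable u)
    (hφ : Continuous φ) (hc : HasCompactSupport φ) : Integrable (fun x => u x * φ x) := by
  simpa [smul_eq_mul, mul_comm] using hu.integrable_smul_left_of_hasCompactSupport hφ hc

theorem HasWeakPartial.ae_unique {i : Fin N} {u v w : Space N → ℝ}
    (hv : HasWeakPartial i u v) (hw : HasWeakPartial i u w) : v =ᵐ[volume] w := by
  refine ae_eq_of_integral_contDiff_smul_eq hv.2.1 hw.2.1 fun φ h1 h2 => ?_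
  have e1 := hv.2.2 φ ⟨h1, h2⟩
  have e2 := hw.2.2 φ ⟨h1, h2⟩
  simp only [smul_eq_mul, mul_comm (φ _)]
  linarith

theorem HasWeakPartial.congr {i : Fin N} {u u' v v' : Space N → ℝ}
    (h : HasWeakPartial i u v) (hu : u =ᵐ[volume] u') (hv : v =ᵐ[volume] v') :
    HasWeakPartial i u' v' := by
  refine ⟨(locallyIntegrable_congr hu).1 h.1, (locallyIntegrable_congr hv).1 h.2.1, fun φ hφ => ?_⟩
  have e1 : ∫ x, u x * partialDeriv i φ x = ∫ x, u' x * partialDeriv i φ x :=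
    integral_congr_ae (hu.mul (ae_eq_refl (partialDeriv i φ)))
  have e2 : ∫ x, v x * φ x = ∫ x, v' x * φ x := integral_congr_ae (hv.mul (ae_eq_refl φ))
  rw [← e1, ← e2, h.2.2 φ hφ]

theorem HasWeakPartial.add {i : Fin N} {u u' v v' : Space N → ℝ}
    (h : HasWeakPartial i u v) (h' : HasWeakPartial i u' v') :
    HasWeakPartial i (u + u') (v + v') := by
  refine ⟨h.1.add h'.1, h.2.1.add h'.2.1, fun φ hφ => ?_⟩
  simp only [Pi.add_apply, add_mul]
  rw [integral_add, integral_add, h.2.2 φ hφ, h'.2.2 φ hφ]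
  · ring
  · exact h.2.1.integrable_mul_of_hasCompactSupport hφ.continuous hφ.2
  · exact h'.2.1.integrable_mul_of_hasCompactSupport hφ.continuous hφ.2
  · exact h.1.integrable_mul_of_hasCompactSupport (hφ.continuous_partialDeriv i)
      (hφ.hasCompactSupport_partialDeriv i)
  · exact h'.1.integrable_mul_of_hasCompactSupport (hφ.continuous_partialDeriv i)
      (hφ.hasCompactSupport_partialDeriv i)

theorem hasWeakPartial_zero (i : Fin N) : HasWeakPartial i (0 : Space N → ℝ) 0 :=
  ⟨locallyIntegrable_zero, locallyIntegrable_zero, fun φ _ => by simp⟩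

theorem HasWeakPartial.weakPartial {i : Fin N} {u v : Space N → ℝ}
    (h : HasWeakPartial i u v) : HasWeakPartial i u (weakPartial i u) := by
  have h' : ∃ v, HasWeakPartial i u v := ⟨v, h⟩
  rw [Polyharmonic.weakPartial, dif_pos h']
  exact h'.choose_spec

theorem HasWeakPartial.weakPartial_ae_eq {i : Fin N} {u v : Space N → ℝ}
    (h : HasWeakPartial i u v) : Polyharmonic.weakPartial i u =ᵐ[volume] v :=
  h.weakPartial.ae_unique h

theorem weakPartial_congr {i : Fin N} {u u' : Space N → ℝ} (hu : u =ᵐ[volume] u') :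
    weakPartial i u =ᵐ[volume] weakPartial i u' := by
  by_cases h : ∃ v, HasWeakPartial i u v
  · obtain ⟨v, hv⟩ := h
    exact hv.weakPartial_ae_eq.trans (hv.congr hu (ae_eq_refl v)).weakPartial_ae_eq.symm
  -- Without a weak derivative both sides take the default value 0.
  · have h' : ¬ ∃ v, HasWeakPartial i u' v := fun ⟨v, hv⟩ =>
      h ⟨v, hv.congr hu.symm (ae_eq_refl v)⟩
    rw [weakPartial, weakPartial, dif_neg h, dif_neg h']

theorem weakLaplacian_congr {u u' : Space N → ℝ} (hu : u =ᵐ[volume] u') :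
    weakLaplacian u =ᵐ[volume] weakLaplacian u' := by
  have h : ∀ i : Fin N, weakPartial i (weakPartial i u) =ᵐ[volume]
      weakPartial i (weakPartial i u') := fun i => weakPartial_congr (weakPartial_congr hu)
  filter_upwards [ae_all_iff.2 h] with x hx
  simp only [weakLaplacian, hx]

theorem iterate_weakLaplacian_congr {u u' : Space N → ℝ} (hu : u =ᵐ[volume] u') (j : ℕ) :
    weakLaplacian^[j] u =ᵐ[volume] weakLaplacian^[j] u' := by
  induction j with
  | zero => exact hu
  | succ j ih =>
    rw [Function.iterate_succ_apply', Function.iterate_succ_apply']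
    exact weakLaplacian_congr ih

/-! ### The spaces `H^k` -/

theorem MemH.memLp {k : ℕ} {u : Space N → ℝ} (h : MemH k u) : MemLp u 2 volume := by
  cases k with
  | zero => exact h
  | succ k => exact h.1

theorem MemH.congr {k : ℕ} {u u' : Space N → ℝ} (h : MemH k u) (hu : u =ᵐ[volume] u') :
    MemH k u' := by
  cases k with
  | zero => exact MemLp.ae_eq hu h
  | succ k =>
    refine ⟨MemLp.ae_eq hu h.1, fun i => ?_⟩
    obtain ⟨v, hv, hk⟩ := h.2 i
    exact ⟨v, hv.congr hu (ae_eq_refl v), hk⟩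

theorem MemH.hasWeakPartial {k : ℕ} {u : Space N → ℝ} (h : MemH (k + 1) u) (i : Fin N) :
    HasWeakPartial i u (weakPartial i u) := by
  obtain ⟨v, hv, -⟩ := h.2 i
  exact hv.weakPartial

theorem MemH.weakPartial {k : ℕ} {u : Space N → ℝ} (h : MemH (k + 1) u) (i : Fin N) :
    MemH k (weakPartial i u) := by
  obtain ⟨v, hv, hk⟩ := h.2 i
  exact hk.congr hv.weakPartial_ae_eq.symm

theorem MemH.add {k : ℕ} : ∀ {u v : Space N → ℝ}, MemH k u → MemH k v → MemH k (u + v) := by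
  induction k with
  | zero => exact fun h h' => MemLp.add h h'
  | succ k ih =>
    intro u v h h'
    refine ⟨h.1.add h'.1, fun i => ?_⟩
    obtain ⟨a, ha, hka⟩ := h.2 i
    obtain ⟨b, hb, hkb⟩ := h'.2 i
    exact ⟨a + b, ha.add hb, ih hka hkb⟩

theorem memH_zero {k : ℕ} : MemH k (0 : Space N → ℝ) := by
  induction k with
  | zero => exact MemLp.zero
  | succ k ih => exact ⟨MemLp.zero, fun i => ⟨0, hasWeakPartial_zero i, ih⟩⟩

theorem MemH.sum {k : ℕ} {ι : Type*} (s : Finset ι) {f : ι → Space N → ℝ}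
    (h : ∀ i ∈ s, MemH k (f i)) : MemH k (∑ i ∈ s, f i) := by
  classical
  induction s using Finset.induction_on with
  | empty => simpa using memH_zero
  | insert a s ha ih =>
    rw [Finset.sum_insert ha]
    exact (h a (by simp)).add (ih fun i hi => h i (by simp [hi]))

theorem weakLaplacian_eq_sum (u : Space N → ℝ) :
    weakLaplacian u = ∑ i : Fin N, weakPartial i (weakPartial i u) := by
  ext x
  simp [weakLaplacian]

theorem MemH.weakLaplacian {k : ℕ} {u : Space N → ℝ} (h : MemH (k + 2) u) :
    MemH k (weakLaplacian u) := by
  rw [weakLaplacian_eq_sum]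
  exact MemH.sum _ fun i _ => (h.weakPartial i).weakPartial i

theorem MemH.iterate_weakLaplacian {k : ℕ} (j : ℕ) {u : Space N → ℝ} (h : MemH (2 * j + k) u) :
    MemH k (Polyharmonic.weakLaplacian^[j] u) := by
  induction j generalizing u with
  | zero => simpa using h
  | succ j ih =>
    rw [Function.iterate_succ_apply]
    apply ih
    apply MemH.weakLaplacian
    convert h using 1
    ring

/-- The leftover regularity m % 2 is exactly the one extra derivative needed for the outer gradient
when m is odd. -/
theorem MemH.iterate_weakLaplacian_half {m : ℕ} {u : Space N → ℝ} (h : MemH m u) :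
    MemH (m % 2) (Polyharmonic.weakLaplacian^[m / 2] u) :=
  MemH.iterate_weakLaplacian _ (by rwa [Nat.div_add_mod])

theorem MemH.integrable_polyGradSq {m : ℕ} {u : Space N → ℝ} (h : MemH m u) :
    Integrable (polyGradSq m u) := by
  have h' := h.iterate_weakLaplacian_half
  unfold polyGradSq polyGradMul
  by_cases hm : Even m
  · rw [Nat.even_iff.1 hm] at h'
    simp only [hm, if_true, ← sq]
    exact h'.memLp.integrable_sq
  · rw [Nat.not_even_iff.1 hm] at h'
    simp only [hm, if_false, ← sq]
    exact integrable_finsetSum _ fun i _ => (h'.weakPartial (k := 0) i).memLp.integrable_sq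

theorem polyGradSq_nonneg (m : ℕ) (u : Space N → ℝ) (x : Space N) : 0 ≤ polyGradSq m u x := by
  unfold polyGradSq polyGradMul
  split_ifs
  · exact mul_self_nonneg _
  · exact Finset.sum_nonneg fun i _ => mul_self_nonneg _

/-! ### Dilations and translations -/

/-- The function `x ↦ c u(s x + τ)`. -/
def dilate (c s : ℝ) (τ : Space N) (u : Space N → ℝ) (x : Space N) : ℝ := c * u (s • x + τ)

theorem integral_comp_dilate {s : ℝ} (hs : 0 < s) (τ : Space N) (f : Space N → ℝ) :
    ∫ x, f (s • x + τ) = (s ^ N)⁻¹ * ∫ x, f x := by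
  have := Measure.integral_comp_smul (volume : Measure (Space N)) (fun y => f (y + τ)) s
  rw [this, integral_add_right_eq_self (μ := volume) f τ]
  simp [abs_of_pos hs]

theorem map_dilate {s : ℝ} (hs : 0 < s) (τ : Space N) :
    Measure.map (fun x : Space N => s • x + τ) volume =
      ENNReal.ofReal ((s ^ N)⁻¹) • (volume : Measure (Space N)) := by
  have h1 : Measure.map (fun x : Space N => s • x + τ) volume =
      Measure.map (fun x => x + τ) (Measure.map (fun x : Space N => s • x) volume) := by
    rw [Measure.map_map (by fun_prop) (by fun_prop)]; rfl
  rw [h1, Measure.map_addHaar_smul _ hs.ne', Measure.map_smul, map_add_right_eq_self]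
  simp [abs_of_pos hs]

theorem _root_.MeasureTheory.MemLp.dilate {p : ℝ≥0∞} {u : Space N → ℝ} (h : MemLp u p volume)
    (c : ℝ) {s : ℝ} (hs : 0 < s) (τ : Space N) : MemLp (dilate c s τ u) p volume := by
  refine MemLp.const_mul (f := fun x => u (s • x + τ)) ?_ c
  have h1 : MemLp u p (Measure.map (fun x : Space N => s • x + τ) volume) := by
    rw [map_dilate hs]
    exact h.smul_measure ENNReal.ofReal_ne_top
  exact (memLp_map_measure_iff h1.1 (by fun_prop)).1 h1

theorem IsTest.comp_inv_dilate {φ : Space N → ℝ} (h : IsTest φ) {s : ℝ} (hs : 0 < s)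
    (τ : Space N) : IsTest (fun y => φ (s⁻¹ • (y - τ))) := by
  refine ⟨h.1.comp (by fun_prop), ?_⟩
  exact h.2.comp_homeomorph ((Homeomorph.subRight τ).trans
    (Homeomorph.smulOfNeZero s⁻¹ (inv_ne_zero hs.ne')))

theorem IsTest.partialDeriv_comp_inv_dilate {φ : Space N → ℝ} (h : IsTest φ) (s : ℝ)
    (τ : Space N) (i : Fin N) (y : Space N) :
    partialDeriv i (fun y => φ (s⁻¹ • (y - τ))) y = s⁻¹ * partialDeriv i φ (s⁻¹ • (y - τ)) := by
  have h1 : HasFDerivAt φ (fderiv ℝ φ (s⁻¹ • (y - τ))) (s⁻¹ • (y - τ)) :=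
    ((h.1.differentiable (by simp)) _).hasFDerivAt
  have h2 : HasFDerivAt (fun y : Space N => s⁻¹ • (y - τ))
      (s⁻¹ • ContinuousLinearMap.id ℝ (Space N)) y :=
    ((hasFDerivAt_id y).sub_const τ).const_smul s⁻¹
  have h3 := (h1.comp y h2).fderiv
  unfold partialDeriv
  change fderiv ℝ (φ ∘ fun y : Space N => s⁻¹ • (y - τ)) y _ = _
  rw [h3]
  simp

/-- A change of variables moves the dilation onto the test function, where the chain rule produces
the factor s. The L² hypotheses only supply local integrability of the dilated functions. -/
theorem HasWeakPartial.dilate {i : Fin N} {u v : Space N → ℝ} (h : HasWeakPartial i u v)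
    (hu : MemLp u 2 volume) (hv : MemLp v 2 volume) (c : ℝ) {s : ℝ} (hs : 0 < s) (τ : Space N) :
    HasWeakPartial i (dilate c s τ u) (dilate (c * s) s τ v) := by
  refine ⟨(hu.dilate c hs τ).locallyIntegrable (by norm_num),
    (hv.dilate (c * s) hs τ).locallyIntegrable (by norm_num), fun φ hφ => ?_⟩
  have hψ := hφ.comp_inv_dilate hs τ
  have key := h.2.2 _ hψ
  simp only [hφ.partialDeriv_comp_inv_dilate] at key
  have e1 := integral_comp_dilate hs τ (fun y => u y * (s⁻¹ * partialDeriv i φ (s⁻¹ • (y - τ))))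
  have e2 := integral_comp_dilate hs τ (fun y => v y * φ (s⁻¹ • (y - τ)))
  simp only [add_sub_cancel_right, smul_smul, inv_mul_cancel₀ hs.ne', one_smul] at e1 e2
  have e3 : ∫ x, Polyharmonic.dilate c s τ u x * partialDeriv i φ x =
      c * s * ∫ x, u (s • x + τ) * (s⁻¹ * partialDeriv i φ x) := by
    rw [← integral_const_mul]
    congr 1; ext x
    simp only [Polyharmonic.dilate]
    field_simp
  have e4 : ∫ x, Polyharmonic.dilate (c * s) s τ v x * φ x =
      c * s * ∫ x, v (s • x + τ) * φ x := by
    rw [← integral_const_mul]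
    congr 1; ext x
    simp only [Polyharmonic.dilate]
    ring
  rw [e3, e4, e1, e2, key]
  ring

theorem MemH.dilate {k : ℕ} : ∀ {u : Space N → ℝ}, MemH k u → ∀ (c : ℝ) {s : ℝ}, 0 < s →
    ∀ τ : Space N, MemH k (dilate c s τ u) := by
  induction k with
  | zero => exact fun h c _ hs τ => MemLp.dilate h c hs τ
  | succ k ih =>
    intro u h c s hs τ
    refine ⟨h.1.dilate c hs τ, fun i => ?_⟩
    obtain ⟨v, hv, hk⟩ := h.2 i
    exact ⟨_, hv.dilate h.1 hk.memLp c hs τ, ih hk _ hs τ⟩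

theorem MemH.weakPartial_dilate {k : ℕ} {u : Space N → ℝ} (h : MemH (k + 1) u) (i : Fin N)
    (c : ℝ) {s : ℝ} (hs : 0 < s) (τ : Space N) :
    Polyharmonic.weakPartial i (Polyharmonic.dilate c s τ u) =ᵐ[volume]
      Polyharmonic.dilate (c * s) s τ (Polyharmonic.weakPartial i u) :=
  ((h.hasWeakPartial i).dilate h.1 (h.weakPartial i).memLp c hs τ).weakPartial_ae_eq

theorem MemH.weakLaplacian_dilate {k : ℕ} {u : Space N → ℝ} (h : MemH (k + 2) u)
    (c : ℝ) {s : ℝ} (hs : 0 < s) (τ : Space N) :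
    Polyharmonic.weakLaplacian (Polyharmonic.dilate c s τ u) =ᵐ[volume]
      Polyharmonic.dilate (c * s ^ 2) s τ (Polyharmonic.weakLaplacian u) := by
  have h1 : ∀ i : Fin N, Polyharmonic.weakPartial i (Polyharmonic.weakPartial i
      (Polyharmonic.dilate c s τ u)) =ᵐ[volume] Polyharmonic.dilate (c * s * s) s τ
        (Polyharmonic.weakPartial i (Polyharmonic.weakPartial i u)) := fun i =>
    (weakPartial_congr (h.weakPartial_dilate i c hs τ)).trans
      ((h.weakPartial i).weakPartial_dilate i (c * s) hs τ)
  filter_upwards [ae_all_iff.2 h1] with x hx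
  simp only [Polyharmonic.weakLaplacian, hx, Polyharmonic.dilate, Finset.mul_sum]
  refine Finset.sum_congr rfl fun i _ => by ring

theorem MemH.iterate_weakLaplacian_dilate {k : ℕ} (j : ℕ) {u : Space N → ℝ}
    (h : MemH (2 * j + k) u) (c : ℝ) {s : ℝ} (hs : 0 < s) (τ : Space N) :
    Polyharmonic.weakLaplacian^[j] (Polyharmonic.dilate c s τ u) =ᵐ[volume]
      Polyharmonic.dilate (c * s ^ (2 * j)) s τ (Polyharmonic.weakLaplacian^[j] u) := by
  induction j generalizing u c with
  | zero => simp
  | succ j ih =>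
    rw [Function.iterate_succ_apply, Function.iterate_succ_apply]
    have h' : MemH (2 * j + k + 2) u := by convert h using 1; ring
    have := (iterate_weakLaplacian_congr (h'.weakLaplacian_dilate c hs τ) j).trans
      (ih h'.weakLaplacian (c * s ^ 2))
    convert this using 2
    ring

/-- Each Laplacian contributes s² and the odd gradient s, so the square carries s^{2m} in both
parities. -/
theorem MemH.polyGradSq_dilate {m : ℕ} {u : Space N → ℝ} (h : MemH m u)
    (c : ℝ) {s : ℝ} (hs : 0 < s) (τ : Space N) :
    polyGradSq m (Polyharmonic.dilate c s τ u) =ᵐ[volume]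
      fun x => c ^ 2 * s ^ (2 * m) * polyGradSq m u (s • x + τ) := by
  have hm' := Nat.div_add_mod m 2
  have h0 : MemH (2 * (m / 2) + m % 2) u := by rwa [hm']
  have hd := h0.iterate_weakLaplacian_dilate (m / 2) c hs τ
  have h' := h.iterate_weakLaplacian_half
  unfold polyGradSq polyGradMul
  by_cases hm : Even m
  · rw [Nat.even_iff.1 hm] at hm'
    filter_upwards [hd] with x hx
    simp only [hm, if_true, hx, Polyharmonic.dilate]
    conv_rhs => rw [← hm']
    simp only [add_zero, Nat.mul_div_cancel_left _ (Nat.zero_lt_two)]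
    ring
  · rw [Nat.not_even_iff.1 hm] at h' hm'
    have h1 : ∀ i : Fin N, Polyharmonic.weakPartial i
        (Polyharmonic.weakLaplacian^[m / 2] (Polyharmonic.dilate c s τ u)) =ᵐ[volume] _ := fun i =>
      (weakPartial_congr hd).trans (MemH.weakPartial_dilate (k := 0) h' i _ hs τ)
    filter_upwards [ae_all_iff.2 h1] with x hx
    simp only [hm, if_false, hx, Polyharmonic.dilate, Finset.mul_sum]
    refine Finset.sum_congr rfl fun i _ => ?_
    have e : s ^ (2 * m) = (s ^ (2 * (m / 2)) * s) ^ 2 := by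
      conv_lhs => rw [← hm']
      ring
    rw [e]
    ring

theorem MemH.integral_polyGradSq_dilate {m : ℕ} {u : Space N → ℝ} (h : MemH m u)
    (c : ℝ) {s : ℝ} (hs : 0 < s) (τ : Space N) :
    ∫ x, polyGradSq m (Polyharmonic.dilate c s τ u) x =
      c ^ 2 * s ^ (2 * m) * (s ^ N)⁻¹ * ∫ x, polyGradSq m u x := by
  rw [integral_congr_ae (h.polyGradSq_dilate c hs τ), integral_const_mul,
    integral_comp_dilate hs τ (polyGradSq m u)]
  ring

end

section

open scoped FourierTransform LineDeriv SchwartzMap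

variable {N : ℕ}

/-! ### Weak derivatives tested against square integrable functions -/

/-- A smooth cutoff function with bounded partial derivatives. -/
theorem exists_cutoff (N : ℕ) : ∃ χ : Space N → ℝ, IsTest χ ∧ χ 0 = 1 ∧ (∀ x, |χ x| ≤ 1) ∧
    ∃ M, ∀ i x, |partialDeriv i χ x| ≤ M := by
  let b : ContDiffBump (0 : Space N) := ⟨1, 2, one_pos, one_lt_two⟩
  have hb : IsTest (b : Space N → ℝ) := ⟨b.contDiff, b.hasCompactSupport⟩
  refine ⟨b, hb, b.one_of_mem_closedBall (by simp [b]), fun x => ?_, ?_⟩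
  · rw [abs_of_nonneg b.nonneg]
    exact b.le_one
  · have h : ∀ i : Fin N, ∃ M, ∀ x, |partialDeriv i b x| ≤ M := fun i =>
      (hb.continuous_partialDeriv i).bounded_above_of_compact_support
        (hb.hasCompactSupport_partialDeriv i)
    choose M hM using h
    refine ⟨∑ i, |M i|, fun i x => (hM i x).trans ((le_abs_self _).trans ?_)⟩
    exact Finset.single_le_sum (f := fun i => |M i|) (fun i _ => abs_nonneg _) (Finset.mem_univ i)

theorem partialDeriv_mul {φ ψ : Space N → ℝ} {x : Space N} (hφ : DifferentiableAt ℝ φ x)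
    (hψ : DifferentiableAt ℝ ψ x) (i : Fin N) :
    partialDeriv i (fun y => φ y * ψ y) x =
      φ x * partialDeriv i ψ x + partialDeriv i φ x * ψ x := by
  unfold partialDeriv
  rw [fderiv_fun_mul hφ hψ]
  simp [mul_comm]

/-- Multiplying φ by a cutoff χ(x/r) gives a genuine test function; the error term in the product
rule carries 1/r and vanishes by dominated convergence. This admits Schwartz functions, which need
not have compact support. -/
theorem HasWeakPartial.integral_mul_partialDeriv {i : Fin N} {u v φ : Space N → ℝ}
    (h : HasWeakPartial i u v) (hu : MemLp u 2 volume) (hv : MemLp v 2 volume)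
    (hφ : ContDiff ℝ ∞ φ) (hφ2 : MemLp φ 2 volume) (hdφ : MemLp (partialDeriv i φ) 2 volume) :
    ∫ x, u x * partialDeriv i φ x = - ∫ x, v x * φ x := by
  obtain ⟨χ, hχ, hχ0, hχ1, M, hM⟩ := exists_cutoff N
  -- Starting at radius 1 keeps r⁻¹ ≤ 1, so one dominating function serves all n.
  let r : ℕ → ℝ := fun n => (n : ℝ) + 1
  have hr : ∀ n, 0 < r n := fun n => by positivity
  have hχn : ∀ n, IsTest (fun y : Space N => χ ((r n)⁻¹ • y)) := fun n => by
    simpa using hχ.comp_inv_dilate (hr n) 0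
  have hdχn : ∀ n x, partialDeriv i (fun y : Space N => χ ((r n)⁻¹ • y)) x =
      (r n)⁻¹ * partialDeriv i χ ((r n)⁻¹ • x) := fun n x => by
    simpa using hχ.partialDeriv_comp_inv_dilate (r n) 0 i x
  have htest : ∀ n, IsTest (fun y : Space N => χ ((r n)⁻¹ • y) * φ y) := fun n =>
    ⟨(hχn n).1.mul hφ, (hχn n).2.mul_right⟩
  have hpd : ∀ n x, partialDeriv i (fun y : Space N => χ ((r n)⁻¹ • y) * φ y) x =
      χ ((r n)⁻¹ • x) * partialDeriv i φ x + (r n)⁻¹ * partialDeriv i χ ((r n)⁻¹ • x) * φ x := by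
    intro n x
    rw [partialDeriv_mul (((hχn n).1.differentiable (by simp)) x)
      ((hφ.differentiable (by simp)) x), hdχn]
  have hinv : Tendsto (fun n => (r n)⁻¹) atTop (𝓝 0) := by
    simpa [r] using tendsto_one_div_add_atTop_nhds_zero_nat (𝕜 := ℝ)
  have hlim : ∀ x : Space N, Tendsto (fun n => χ ((r n)⁻¹ • x)) atTop (𝓝 1) := fun x => by
    have : Tendsto (fun n => (r n)⁻¹ • x) atTop (𝓝 0) := by simpa using hinv.smul_const x
    rw [← hχ0]
    exact (hχ.continuous.tendsto 0).comp this
  have hL : Tendsto (fun n => ∫ x, u x * partialDeriv i (fun y => χ ((r n)⁻¹ • y) * φ y) x) atTop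
      (𝓝 (∫ x, u x * partialDeriv i φ x)) := by
    refine tendsto_integral_of_dominated_convergence
      (fun x => |u x * partialDeriv i φ x| + M * |u x * φ x|) (fun n => ?_) ?_ (fun n => ?_) ?_
    · exact hu.1.mul ((htest n).continuous_partialDeriv i).aestronglyMeasurable
    · exact (hu.integrable_mul hdφ).abs.add ((hu.integrable_mul hφ2).abs.const_mul M)
    · refine Eventually.of_forall fun x => ?_
      rw [hpd, mul_add]
      refine (norm_add_le _ _).trans (add_le_add ?_ ?_)
      · rw [Real.norm_eq_abs, abs_mul, abs_mul, abs_mul, mul_left_comm]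
        exact mul_le_of_le_one_left (by positivity) (hχ1 _)
      · have h1 : (r n)⁻¹ ≤ 1 := inv_le_one_of_one_le₀ (by simp [r])
        rw [Real.norm_eq_abs, abs_mul, abs_mul, abs_mul, abs_mul,
          abs_of_pos (inv_pos.2 (hr n))]
        have h2 : (r n)⁻¹ * |partialDeriv i χ ((r n)⁻¹ • x)| ≤ M :=
          (mul_le_of_le_one_left (abs_nonneg _) h1).trans (hM i _)
        calc _ = ((r n)⁻¹ * |partialDeriv i χ ((r n)⁻¹ • x)|) * (|u x| * |φ x|) := by ring
          _ ≤ _ := mul_le_mul_of_nonneg_right h2 (by positivity)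
    · refine Eventually.of_forall fun x => ?_
      simp only [hpd]
      have h2 : Tendsto (fun n => (r n)⁻¹ * partialDeriv i χ ((r n)⁻¹ • x)) atTop (𝓝 0) := by
        refine squeeze_zero_norm (a := fun n => (r n)⁻¹ * M) (fun n => ?_) (by
          simpa using hinv.mul_const M)
        rw [norm_mul, Real.norm_of_nonneg (inv_pos.2 (hr n)).le]
        exact mul_le_mul_of_nonneg_left (hM i _) (inv_pos.2 (hr n)).le
      simpa using (((hlim x).mul_const (partialDeriv i φ x)).add (h2.mul_const (φ x))).const_mul
        (u x)
  have hR : Tendsto (fun n => - ∫ x, v x * (χ ((r n)⁻¹ • x) * φ x)) atTop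
      (𝓝 (- ∫ x, v x * φ x)) := by
    refine (tendsto_integral_of_dominated_convergence
      (fun x => |v x * φ x|) (fun n => ?_) ?_ (fun n => ?_) ?_).neg
    · exact hv.1.mul (htest n).continuous.aestronglyMeasurable
    · exact (hv.integrable_mul hφ2).abs
    · refine Eventually.of_forall fun x => ?_
      rw [Real.norm_eq_abs, abs_mul, abs_mul, abs_mul, mul_left_comm]
      exact mul_le_of_le_one_left (by positivity) (hχ1 _)
    · refine Eventually.of_forall fun x => ?_
      simpa using ((hlim x).mul_const (φ x)).const_mul (v x)
  refine tendsto_nhds_unique hL (hR.congr fun n => ?_)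
  exact (h.2.2 _ (htest n)).symm

theorem partialDeriv_clm_comp {f : Space N → ℂ} {x : Space N} (hf : DifferentiableAt ℝ f x)
    (L : ℂ →L[ℝ] ℝ) (i : Fin N) :
    partialDeriv i (fun y => L (f y)) x = L (fderiv ℝ f x (EuclideanSpace.single i 1)) := by
  unfold partialDeriv
  have := (L.hasFDerivAt.comp x hf.hasFDerivAt).fderiv
  rw [show (fun y => L (f y)) = L ∘ f from rfl, this]
  rfl

theorem HasWeakPartial.integral_lineDeriv_schwartz {i : Fin N} {u v : Space N → ℝ}
    (h : HasWeakPartial i u v) (hu : MemLp u 2 volume) (hv : MemLp v 2 volume)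
    (ψ : 𝓢(Space N, ℂ)) :
    ∫ x, (∂_{(EuclideanSpace.single i 1 : Space N)} ψ) x * (u x : ℂ) =
      - ∫ x, ψ x * (v x : ℂ) := by
  set e : Space N := EuclideanSpace.single i 1
  have hd : ∀ x, (∂_{e} ψ) x = fderiv ℝ ψ x e := fun x =>
    SchwartzMap.lineDerivOp_apply_eq_fderiv _ _ _
  have hψ2 : MemLp ψ 2 volume := ψ.memLp 2
  have hdψ2 : MemLp (⇑(∂_{e} ψ : 𝓢(Space N, ℂ))) 2 volume := (∂_{e} ψ).memLp 2
  -- Weak derivatives are tested against real functions, so the complex identity is obtained from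
  -- its real and imaginary parts.
  have key : ∀ L : ℂ →L[ℝ] ℝ, ∫ x, u x * L ((∂_{e} ψ) x) = - ∫ x, v x * L (ψ x) := by
    intro L
    have e1 : ∀ x, partialDeriv i (fun y => L (ψ y)) x = L ((∂_{e} ψ) x) := fun x => by
      rw [partialDeriv_clm_comp (ψ.differentiableAt) L i, hd]
    have := h.integral_mul_partialDeriv hu hv (φ := fun y => L (ψ y))
      (L.contDiff.comp (ψ.smooth ⊤)) (L.comp_memLp' hψ2) (by
        rw [funext e1]
        exact L.comp_memLp' hdψ2)
    simpa only [e1] using this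
  have hint1 : Integrable (fun x => (∂_{e} ψ) x * (u x : ℂ)) :=
    hdψ2.integrable_mul (hu.ofReal (K := ℂ))
  have hint2 : Integrable (fun x => ψ x * (v x : ℂ)) := hψ2.integrable_mul (hv.ofReal (K := ℂ))
  have hre : ∀ {f : Space N → ℂ}, Integrable f → (∫ x, f x).re = ∫ x, (f x).re := fun hf =>
    (Complex.reCLM.integral_comp_comm hf).symm
  have him : ∀ {f : Space N → ℂ}, Integrable f → (∫ x, f x).im = ∫ x, (f x).im := fun hf =>
    (Complex.imCLM.integral_comp_comm hf).symm
  apply Complex.ext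
  · rw [Complex.neg_re, hre hint1, hre hint2]
    simpa [mul_comm] using key Complex.reCLM
  · rw [Complex.neg_im, him hint1, him hint2]
    simpa [mul_comm] using key Complex.imCLM

/-! ### The Fourier transform of real square integrable functions -/

open Classical in
/-- The Fourier transform of a real square integrable function. -/
def l2Fourier (u : Space N → ℝ) : Space N → ℂ :=
  if h : MemLp u 2 volume then
    ((𝓕 ((h.ofReal (K := ℂ)).toLp _) : Lp ℂ 2 (volume : Measure (Space N))) : Space N → ℂ)
  else 0

theorem l2Fourier_eq {u : Space N → ℝ} (h : MemLp u 2 volume) :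
    l2Fourier u = ((𝓕 ((h.ofReal (K := ℂ)).toLp _) : Lp ℂ 2 (volume : Measure (Space N))) :
      Space N → ℂ) := by
  rw [l2Fourier, dif_pos h]

theorem memLp_l2Fourier (u : Space N → ℝ) : MemLp (l2Fourier u) 2 volume := by
  unfold l2Fourier
  split_ifs
  · exact Lp.memLp _
  · exact MemLp.zero

theorem integral_norm_sq_eq_norm_sq (f : Lp ℂ 2 (volume : Measure (Space N))) :
    ∫ x, ‖f x‖ ^ 2 = ‖f‖ ^ 2 := by
  have h2 := L2.inner_def (𝕜 := ℂ) f f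
  rw [inner_self_eq_norm_sq_to_K] at h2
  have h3 : ∫ x, inner ℂ (f x) (f x) = ∫ x, ((‖f x‖ ^ 2 : ℝ) : ℂ) := by
    congr 1; ext x
    rw [inner_self_eq_norm_sq_to_K]
    push_cast; rfl
  rw [h3, integral_complex_ofReal] at h2
  exact Complex.ofReal_injective (by simpa using h2.symm)

theorem integral_norm_l2Fourier_sq {u : Space N → ℝ} (h : MemLp u 2 volume) :
    ∫ ξ, ‖l2Fourier u ξ‖ ^ 2 = ∫ x, u x ^ 2 := by
  rw [l2Fourier_eq h, integral_norm_sq_eq_norm_sq, Lp.norm_fourier_eq,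
    ← integral_norm_sq_eq_norm_sq]
  refine integral_congr_ae ?_
  filter_upwards [(h.ofReal (K := ℂ)).coeFn_toLp] with x hx
  rw [hx]
  simp

theorem l2Fourier_add {u v : Space N → ℝ} (hu : MemLp u 2 volume) (hv : MemLp v 2 volume) :
    l2Fourier (u + v) =ᵐ[volume] l2Fourier u + l2Fourier v := by
  rw [l2Fourier_eq hu, l2Fourier_eq hv, l2Fourier_eq (hu.add hv)]
  have : ((hu.add hv).ofReal (K := ℂ)).toLp _ =
      (hu.ofReal (K := ℂ)).toLp _ + (hv.ofReal (K := ℂ)).toLp _ := by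
    rw [← MemLp.toLp_add]
    congr 1
    ext x
    simp
  rw [this, FourierTransform.fourier_add]
  exact Lp.coeFn_add _ _

theorem l2Fourier_zero : l2Fourier (0 : Space N → ℝ) =ᵐ[volume] 0 := by
  have h := l2Fourier_add (N := N) (u := 0) (v := 0) MemLp.zero MemLp.zero
  filter_upwards [h] with x hx
  simpa using hx

theorem l2Fourier_sum {ι : Type*} (s : Finset ι) {f : ι → Space N → ℝ}
    (hf : ∀ i ∈ s, MemLp (f i) 2 volume) :
    l2Fourier (∑ i ∈ s, f i) =ᵐ[volume] ∑ i ∈ s, l2Fourier (f i) := by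
  classical
  induction s using Finset.induction_on with
  | empty => simpa using l2Fourier_zero
  | insert a s ha ih =>
    rw [Finset.sum_insert ha, Finset.sum_insert ha]
    have h1 := ih fun i hi => hf i (by simp [hi])
    refine (l2Fourier_add (hf a (by simp)) ?_).trans ((ae_eq_refl _).add h1)
    exact memLp_finsetSum' s fun i hi => hf i (by simp [hi])

/-- Viewed as tempered distributions, the L² classes satisfy ∂_i U = V, and the distributional
Fourier transform turns ∂_i into multiplication by 2πiξ_i. Both sides are locally integrable
functions, so testing against C_c^∞ yields equality almost everywhere. -/
theorem HasWeakPartial.l2Fourier {i : Fin N} {u v : Space N → ℝ}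
    (h : HasWeakPartial i u v) (hu : MemLp u 2 volume) (hv : MemLp v 2 volume) :
    l2Fourier v =ᵐ[volume] fun ξ => (2 * Real.pi * Complex.I) * (ξ i : ℂ) * l2Fourier u ξ := by
  set e : Space N := EuclideanSpace.single i 1
  set U : Lp ℂ 2 (volume : Measure (Space N)) := (hu.ofReal (K := ℂ)).toLp _ with hU
  set V : Lp ℂ 2 (volume : Measure (Space N)) := (hv.ofReal (K := ℂ)).toLp _ with hV
  have hderiv : ∂_{e} (U : 𝓢'(Space N, ℂ)) = (V : 𝓢'(Space N, ℂ)) := by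
    ext ψ
    rw [TemperedDistribution.lineDerivOp_apply_apply, Lp.toTemperedDistribution_apply,
      Lp.toTemperedDistribution_apply]
    have h1 : ∫ x, (-∂_{e} ψ) x • U x = - ∫ x, (∂_{e} ψ) x * (u x : ℂ) := by
      rw [← integral_neg]
      refine integral_congr_ae ?_
      filter_upwards [(hu.ofReal (K := ℂ)).coeFn_toLp] with x hx
      rw [hU, hx]
      simp
    have h2 : ∫ x, ψ x • V x = ∫ x, ψ x * (v x : ℂ) := by
      refine integral_congr_ae ?_
      filter_upwards [(hv.ofReal (K := ℂ)).coeFn_toLp] with x hx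
      rw [hV, hx]
      simp
    rw [h1, h2, h.integral_lineDeriv_schwartz hu hv, neg_neg]
  have hF := TemperedDistribution.fourier_lineDerivOp_eq (U : 𝓢'(Space N, ℂ)) e
  rw [hderiv, Lp.fourier_toTemperedDistribution_eq, Lp.fourier_toTemperedDistribution_eq] at hF
  rw [l2Fourier_eq hu, l2Fourier_eq hv, ← hU, ← hV]
  have hcont : Continuous fun ξ : Space N => (2 * Real.pi * Complex.I) * (ξ i : ℂ) := by fun_prop
  refine ae_eq_of_integral_contDiff_smul_eq ((Lp.memLp (𝓕 V)).locallyIntegrable (by norm_num))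
    (((Lp.memLp (𝓕 U)).locallyIntegrable (by norm_num)).continuous_smul hcont)
    fun g hg hgc => ?_
  have hg' : ContDiff ℝ ∞ (fun x => (g x : ℂ)) := Complex.ofRealCLM.contDiff.comp hg
  have hgc' : HasCompactSupport (fun x => (g x : ℂ)) := hgc.comp_left (g := ((↑) : ℝ → ℂ)) (by simp)
  have := congr($hF (hgc'.toSchwartzMap hg'))
  have htg : Function.HasTemperateGrowth (fun x : Space N => ((inner ℝ x e : ℝ) : ℂ)) := by fun_prop
  simp only [Lp.toTemperedDistribution_apply] at this
  rw [show (((2 * Real.pi * Complex.I : ℂ) • TemperedDistribution.smulLeftCLM ℂ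
      (fun x : Space N => ((inner ℝ x e : ℝ) : ℂ)) ((𝓕 U : Lp ℂ 2 (volume : Measure (Space N))) :
        𝓢'(Space N, ℂ))) (hgc'.toSchwartzMap hg')) =
      (2 * Real.pi * Complex.I : ℂ) • ((TemperedDistribution.smulLeftCLM ℂ
      (fun x : Space N => ((inner ℝ x e : ℝ) : ℂ)) ((𝓕 U : Lp ℂ 2 (volume : Measure (Space N))) :
        𝓢'(Space N, ℂ))) (hgc'.toSchwartzMap hg')) from rfl,
    TemperedDistribution.smulLeftCLM_apply_apply, Lp.toTemperedDistribution_apply,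
    ← integral_smul] at this
  refine Eq.trans (integral_congr_ae (Eventually.of_forall fun x => ?_))
    (this.trans (integral_congr_ae (Eventually.of_forall fun x => ?_)))
  · simp
  · have e3 := SchwartzMap.smulLeftCLM_apply_apply htg (hgc'.toSchwartzMap hg') x
    have e4 : (inner ℝ x e : ℝ) = x i := by simp [e, EuclideanSpace.inner_single_right]
    have e5 : hgc'.toSchwartzMap hg' x = (g x : ℂ) := rfl
    beta_reduce
    rw [e3, e4, e5]
    simp
    ring

theorem ofReal_norm_sq_eq_sum (ξ : Space N) : ((‖ξ‖ ^ 2 : ℝ) : ℂ) = ∑ i, (ξ i : ℂ) ^ 2 := by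
  rw [EuclideanSpace.real_norm_sq_eq]
  push_cast
  rfl

theorem MemH.l2Fourier_weakLaplacian {k : ℕ} {u : Space N → ℝ} (h : MemH (k + 2) u) :
    Polyharmonic.l2Fourier (Polyharmonic.weakLaplacian u) =ᵐ[volume]
      fun ξ => (-((2 * Real.pi * ‖ξ‖) ^ 2 : ℝ) : ℂ) * Polyharmonic.l2Fourier u ξ := by
  rw [weakLaplacian_eq_sum]
  have h1 : ∀ i : Fin N, Polyharmonic.l2Fourier
      (Polyharmonic.weakPartial i (Polyharmonic.weakPartial i u)) =ᵐ[volume] _ := fun i =>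
    ((h.weakPartial i).hasWeakPartial i).l2Fourier (h.weakPartial i).memLp
      ((h.weakPartial i).weakPartial i).memLp
  have h2 : ∀ i : Fin N, Polyharmonic.l2Fourier (Polyharmonic.weakPartial i u) =ᵐ[volume] _ :=
    fun i => (h.hasWeakPartial i).l2Fourier h.memLp (h.weakPartial i).memLp
  filter_upwards [l2Fourier_sum Finset.univ
    (f := fun i => Polyharmonic.weakPartial i (Polyharmonic.weakPartial i u))
    (fun i _ => ((h.weakPartial i).weakPartial i).memLp), ae_all_iff.2 h1, ae_all_iff.2 h2]
    with ξ a b c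
  rw [a, Finset.sum_apply]
  simp only [b, c]
  rw [mul_pow, Complex.ofReal_mul, ofReal_norm_sq_eq_sum, Finset.mul_sum, ← Finset.sum_neg_distrib,
    Finset.sum_mul]
  refine Finset.sum_congr rfl fun i _ => ?_
  push_cast
  linear_combination (4 * (Real.pi : ℂ) ^ 2 * (ξ i : ℂ) ^ 2 * Polyharmonic.l2Fourier u ξ) *
    Complex.I_sq

theorem MemH.l2Fourier_iterate_weakLaplacian {k : ℕ} (j : ℕ) {u : Space N → ℝ}
    (h : MemH (2 * j + k) u) :
    Polyharmonic.l2Fourier (Polyharmonic.weakLaplacian^[j] u) =ᵐ[volume]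
      fun ξ => (-((2 * Real.pi * ‖ξ‖) ^ 2 : ℝ) : ℂ) ^ j * Polyharmonic.l2Fourier u ξ := by
  induction j generalizing u with
  | zero => simp
  | succ j ih =>
    rw [Function.iterate_succ_apply]
    have h' : MemH (2 * j + k + 2) u := by convert h using 1; ring
    filter_upwards [ih h'.weakLaplacian, h'.l2Fourier_weakLaplacian] with ξ a b
    rw [a, b]
    ring

theorem norm_neg_ofReal_sq_pow (T : ℝ) (j : ℕ) : ‖(-((T ^ 2 : ℝ) : ℂ)) ^ j‖ = (T ^ 2) ^ j := by
  rw [norm_pow, norm_neg, Complex.norm_real, Real.norm_of_nonneg (sq_nonneg T)]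

/-- Plancherel for the top-order derivatives. For odd m, summing ξ_i² over the gradient components
restores the missing |ξ|², so both parities give the multiplier |2πξ|^{2m}. -/
theorem MemH.integral_polyGradSq_eq {m : ℕ} {u : Space N → ℝ} (h : MemH m u) :
    Integrable (fun ξ : Space N => (2 * Real.pi * ‖ξ‖) ^ (2 * m) * ‖Polyharmonic.l2Fourier u ξ‖ ^ 2)
    ∧ ∫ x, polyGradSq m u x =
      ∫ ξ, (2 * Real.pi * ‖ξ‖) ^ (2 * m) * ‖Polyharmonic.l2Fourier u ξ‖ ^ 2 := by
  have hm' := Nat.div_add_mod m 2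
  have h0 : MemH (2 * (m / 2) + m % 2) u := by rwa [hm']
  have hd := h0.l2Fourier_iterate_weakLaplacian (m / 2)
  have h' := h.iterate_weakLaplacian_half
  unfold polyGradSq polyGradMul
  by_cases hm : Even m
  · rw [Nat.even_iff.1 hm] at hm' h'
    simp only [hm, if_true, ← sq]
    rw [← integral_norm_l2Fourier_sq h'.memLp]
    have key : (fun ξ => ‖Polyharmonic.l2Fourier (Polyharmonic.weakLaplacian^[m / 2] u) ξ‖ ^ 2)
        =ᵐ[volume] fun ξ => (2 * Real.pi * ‖ξ‖) ^ (2 * m) * ‖Polyharmonic.l2Fourier u ξ‖ ^ 2 := by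
      filter_upwards [hd] with ξ hξ
      rw [hξ, norm_mul, mul_pow, norm_neg_ofReal_sq_pow]
      conv_rhs => rw [← hm']
      generalize 2 * Real.pi * ‖ξ‖ = T
      ring
    exact ⟨((memLp_l2Fourier _).integrable_norm_pow (by norm_num)).congr key,
      integral_congr_ae key⟩
  · rw [Nat.not_even_iff.1 hm] at h' hm'
    simp only [hm, if_false, ← sq]
    rw [integral_finsetSum _ fun i _ => (h'.weakPartial (k := 0) i).memLp.integrable_sq]
    have h1 : ∀ i : Fin N, Polyharmonic.l2Fourier (Polyharmonic.weakPartial i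
        (Polyharmonic.weakLaplacian^[m / 2] u)) =ᵐ[volume] _ := fun i =>
      (MemH.hasWeakPartial (k := 0) h' i).l2Fourier h'.memLp
        (h'.weakPartial (k := 0) i).memLp
    have hint : ∀ i : Fin N, Integrable fun ξ => ‖Polyharmonic.l2Fourier (Polyharmonic.weakPartial i
        (Polyharmonic.weakLaplacian^[m / 2] u)) ξ‖ ^ 2 := fun i =>
      (memLp_l2Fourier _).integrable_norm_pow (by norm_num)
    have key : (fun ξ => ∑ i, ‖Polyharmonic.l2Fourier (Polyharmonic.weakPartial i
        (Polyharmonic.weakLaplacian^[m / 2] u)) ξ‖ ^ 2) =ᵐ[volume]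
        fun ξ => (2 * Real.pi * ‖ξ‖) ^ (2 * m) * ‖Polyharmonic.l2Fourier u ξ‖ ^ 2 := by
      filter_upwards [hd, ae_all_iff.2 h1] with ξ a b
      simp only [b, a]
      have e1 : ∀ i, ‖2 * Real.pi * Complex.I * (ξ i : ℂ) *
          ((-((2 * Real.pi * ‖ξ‖) ^ 2 : ℝ) : ℂ) ^ (m / 2) * Polyharmonic.l2Fourier u ξ)‖ ^ 2 =
          ξ i ^ 2 * ((2 * Real.pi) ^ 2 * ((2 * Real.pi * ‖ξ‖) ^ 2) ^ (m / 2 * 2) *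
            ‖Polyharmonic.l2Fourier u ξ‖ ^ 2) := by
        intro i
        have e2 : ‖2 * Real.pi * Complex.I * (ξ i : ℂ)‖ ^ 2 = (2 * Real.pi) ^ 2 * ξ i ^ 2 := by
          simp [mul_pow]
        rw [norm_mul, mul_pow, e2, norm_mul, norm_neg_ofReal_sq_pow]
        generalize 2 * Real.pi * ‖ξ‖ = T
        ring
      rw [Finset.sum_congr rfl fun i _ => e1 i, ← Finset.sum_mul, ← EuclideanSpace.real_norm_sq_eq,
        mul_assoc, ← mul_assoc, ← mul_pow, mul_comm ‖ξ‖]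
      conv_rhs => rw [← hm']
      generalize 2 * Real.pi * ‖ξ‖ = T
      ring
    refine ⟨(integrable_finsetSum _ fun i _ => hint i).congr key, ?_⟩
    rw [← integral_congr_ae key, integral_finsetSum _ fun i _ => hint i]
    exact Finset.sum_congr rfl fun i _ =>
      (integral_norm_l2Fourier_sq (h'.weakPartial (k := 0) i).memLp).symm

end

section

open scoped FourierTransform LineDeriv SchwartzMap

variable {N : ℕ}

/-! ### The Gagliardo–Nirenberg inequality -/

/-- Fubini, together with the symmetry of the kernel in its two variables. -/
theorem integral_fourierInv_smul_eq {f g : Space N → ℂ} (hf : Integrable f) (hg : Integrable g) :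
    ∫ ξ, 𝓕⁻ f ξ • g ξ = ∫ x, f x • 𝓕⁻ g x := by
  have := VectorFourier.integral_fourierIntegral_smul_eq_flip (L := -innerₗ (Space N))
    (μ := volume) (ν := volume) Real.continuous_fourierChar
    (by simp only [LinearMap.neg_apply]; exact continuous_inner.neg) hf hg
  have h2 : (-innerₗ (Space N)).flip = -innerₗ (Space N) := by
    ext x y
    simp [real_inner_comm]
  rw [h2] at this
  exact this

/-- The L² inverse transform has no pointwise formula by itself; pairing with test functions
identifies it with the integral when g is also in L¹. That makes the low-frequency part bounded by
the L¹ norm of its transform. -/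
theorem fourierInv_ae_eq_of_integrable (g : Lp ℂ 2 (volume : Measure (Space N)))
    (hg : Integrable g) :
    ((𝓕⁻ g : Lp ℂ 2 (volume : Measure (Space N))) : Space N → ℂ) =ᵐ[volume]
      𝓕⁻ (g : Space N → ℂ) := by
  have hloc : LocallyIntegrable (𝓕⁻ (g : Space N → ℂ)) := by
    have hc : Continuous (𝓕⁻ (g : Space N → ℂ)) :=
      VectorFourier.fourierIntegral_continuous Real.continuous_fourierChar
        (L := -innerₗ (Space N))
        (by simp only [LinearMap.neg_apply]; exact continuous_inner.neg) hg
    exact hc.locallyIntegrable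
  refine ae_eq_of_integral_contDiff_smul_eq ((Lp.memLp (𝓕⁻ g)).locallyIntegrable (by norm_num))
    hloc fun φ hφ hφc => ?_
  have hφ' : ContDiff ℝ ∞ (fun x => (φ x : ℂ)) := Complex.ofRealCLM.contDiff.comp hφ
  have hφc' : HasCompactSupport (fun x => (φ x : ℂ)) :=
    hφc.comp_left (g := ((↑) : ℝ → ℂ)) (by simp)
  have hT := congr($(Lp.fourierInv_toTemperedDistribution_eq g) (hφc'.toSchwartzMap hφ'))
  rw [TemperedDistribution.fourierInv_apply, Lp.toTemperedDistribution_apply,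
    Lp.toTemperedDistribution_apply, SchwartzMap.fourierInv_coe,
    integral_fourierInv_smul_eq (SchwartzMap.integrable _) hg] at hT
  exact hT.symm

theorem norm_fourierInv_le (g : Space N → ℂ) (x : Space N) : ‖𝓕⁻ g x‖ ≤ ∫ ξ, ‖g ξ‖ :=
  VectorFourier.norm_fourierIntegral_le_integral_norm _ _ _ _ _

theorem lintegral_enorm_sq_eq (f : Lp ℂ 2 (volume : Measure (Space N))) :
    ∫⁻ x, ‖f x‖ₑ ^ 2 = ‖f‖ₑ ^ 2 := by
  rw [Lp.enorm_def, eLpNorm_eq_lintegral_rpow_enorm_toReal (by norm_num) (by norm_num)]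
  simp only [ENNReal.toReal_ofNat, ENNReal.rpow_ofNat, one_div]
  rw [← ENNReal.rpow_natCast, ← ENNReal.rpow_mul]
  norm_num

/-- Splitting a square integrable function into its frequencies inside and outside a set of
finite measure. -/
theorem exists_frequency_split (f : Lp ℂ 2 (volume : Measure (Space N))) {S : Set (Space N)}
    (hS : MeasurableSet S) (hfin : volume S ≠ ⊤) :
    ∃ lo hi : Lp ℂ 2 (volume : Measure (Space N)), f = lo + hi ∧
      (∀ᵐ x, ‖lo x‖ₑ ≤ (volume S) ^ (1 / 2 : ℝ) * ‖f‖ₑ) ∧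
      ∫⁻ x, ‖hi x‖ₑ ^ 2 = ∫⁻ ξ in Sᶜ, ‖(𝓕 f : Lp ℂ 2 (volume : Measure (Space N))) ξ‖ₑ ^ 2 := by
  set F : Lp ℂ 2 (volume : Measure (Space N)) := 𝓕 f with hF
  have hmem : MemLp F 2 volume := Lp.memLp F
  set g : Lp ℂ 2 (volume : Measure (Space N)) := (hmem.indicator hS).toLp _ with hg
  set g' : Lp ℂ 2 (volume : Measure (Space N)) := (hmem.indicator hS.compl).toLp _ with hg'
  have hsum : F = g + g' := by
    rw [hg, hg', ← MemLp.toLp_add]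
    refine (Lp.toLp_coeFn F hmem).symm.trans (MemLp.toLp_congr _ _ ?_)
    rw [Set.indicator_self_add_compl]
  have hgae : g =ᵐ[volume] S.indicator F := MemLp.coeFn_toLp _
  have hgae' : g' =ᵐ[volume] Sᶜ.indicator F := MemLp.coeFn_toLp _
  -- Cauchy–Schwarz on S, then Plancherel.
  have hL1 : ∫⁻ ξ, ‖g ξ‖ₑ ≤ (volume S) ^ (1 / 2 : ℝ) * ‖f‖ₑ := by
    have h1 : ∫⁻ ξ, ‖g ξ‖ₑ = ∫⁻ ξ in S, ‖F ξ‖ₑ := by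
      rw [← lintegral_indicator hS]
      refine lintegral_congr_ae ?_
      filter_upwards [hgae] with ξ hξ
      rw [hξ, enorm_indicator_eq_indicator_enorm]
    have h2 := ENNReal.lintegral_mul_le_Lp_mul_Lq (volume.restrict S) Real.HolderConjugate.two_two
      (f := fun _ => 1) (g := fun ξ => ‖F ξ‖ₑ) aemeasurable_const hmem.1.enorm.restrict
    simp only [Pi.mul_apply, one_mul, one_pow, lintegral_const, Measure.restrict_apply_univ,
      ENNReal.rpow_ofNat] at h2
    rw [h1]
    refine h2.trans (mul_le_mul' le_rfl ?_)
    calc (∫⁻ ξ in S, ‖F ξ‖ₑ ^ 2) ^ (1 / 2 : ℝ) ≤ (∫⁻ ξ, ‖F ξ‖ₑ ^ 2) ^ (1 / 2 : ℝ) :=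
          ENNReal.rpow_le_rpow (setLIntegral_le_lintegral _ _) (by norm_num)
      _ = ‖f‖ₑ := by
        rw [lintegral_enorm_sq_eq, ← ENNReal.rpow_natCast, ← ENNReal.rpow_mul]
        norm_num
        rw [← ofReal_norm, ← ofReal_norm, hF, Lp.norm_fourier_eq]
  have hgint : Integrable g := by
    refine ⟨g.1.aestronglyMeasurable, lt_of_le_of_lt hL1 ?_⟩
    exact ENNReal.mul_lt_top (ENNReal.rpow_lt_top_of_nonneg (by norm_num) hfin) enorm_lt_top
  refine ⟨𝓕⁻ g, 𝓕⁻ g', ?_, ?_, ?_⟩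
  · rw [← FourierTransform.fourierInv_add, ← hsum, hF, FourierTransform.fourierInv_fourier_eq]
  · filter_upwards [fourierInv_ae_eq_of_integrable g hgint] with x hx
    rw [hx]
    refine le_trans ?_ hL1
    rw [← ofReal_norm, ← ofReal_integral_norm_eq_lintegral_enorm hgint]
    exact ENNReal.ofReal_le_ofReal (norm_fourierInv_le _ x)
  · rw [lintegral_enorm_sq_eq, ← lintegral_indicator hS.compl]
    have : ‖(𝓕⁻ g' : Lp ℂ 2 (volume : Measure (Space N)))‖ₑ = ‖g'‖ₑ := by
      rw [← ofReal_norm, ← ofReal_norm, ← Lp.norm_fourier_eq (𝓕⁻ g'),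
        FourierTransform.fourier_fourierInv_eq]
    rw [this, ← lintegral_enorm_sq_eq]
    refine lintegral_congr_ae ?_
    filter_upwards [hgae'] with ξ hξ
    rw [hξ]
    by_cases h : ξ ∈ S <;> simp [h]

theorem lintegral_Ioc_rpow {q X : ℝ} (hq : 0 < q) (hX : 0 ≤ X) :
    ∫⁻ t in Set.Ioc 0 X, ENNReal.ofReal (t ^ (q - 1)) = ENNReal.ofReal (X ^ q / q) := by
  have h := intervalIntegral.intervalIntegrable_rpow' (a := 0) (b := X) (r := q - 1) (by linarith)
  rw [intervalIntegrable_iff_integrableOn_Ioc_of_le hX] at h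
  rw [← ofReal_integral_eq_lintegral_ofReal h]
  · rw [← intervalIntegral.integral_of_le hX, integral_rpow (Or.inl (by linarith))]
    simp [Real.zero_rpow hq.ne']
  · filter_upwards [ae_restrict_mem measurableSet_Ioc] with t ht
    exact Real.rpow_nonneg ht.1.le _

/-- The frequency cutoff depends on the level t: it is chosen so that the low frequencies contribute
at most t/2 pointwise. Where |f| > t the high-frequency part then exceeds t/2, and Chebyshev's
inequality in L² applies. The indicator describes the frequencies outside the cutoff ball. -/
theorem meas_lt_norm_le (hN : 0 < N) (f : Lp ℂ 2 (volume : Measure (Space N))) {c : ℝ}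
    (hc : c = 2 * Real.sqrt (volume (Metric.ball (0 : Space N) 1)).toReal * ‖f‖) (hf : 0 < c)
    {t : ℝ} (ht : 0 < t) :
    volume {x | t < ‖f x‖} ≤ ENNReal.ofReal (4 * t ^ (-2 : ℝ)) *
      ∫⁻ ξ, {ξ : Space N | t ≤ c * ‖ξ‖ ^ ((N : ℝ) / 2)}.indicator
        (fun ξ => ‖(𝓕 f : Lp ℂ 2 (volume : Measure (Space N))) ξ‖ₑ ^ 2) ξ := by
  have hN' : (0 : ℝ) < N := by exact_mod_cast hN
  set W := (volume (Metric.ball (0 : Space N) 1)).toReal with hW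
  -- This radius solves |B_A|^{1/2}‖f‖ = t/2.
  set A : ℝ := (t / c) ^ (2 / (N : ℝ)) with hA
  have hA0 : 0 < A := Real.rpow_pos_of_pos (div_pos ht hf) _
  have hAN : A ^ N = (t / c) ^ 2 := by
    rw [hA, ← Real.rpow_natCast, ← Real.rpow_mul (div_pos ht hf).le, div_mul_cancel₀ _ hN'.ne']
    norm_num
  have hvol : volume (Metric.ball (0 : Space N) A) = ENNReal.ofReal ((t / c) ^ 2 * W) := by
    rw [Measure.addHaar_ball_of_pos _ _ hA0, finrank_euclideanSpace_fin, hAN,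
      ENNReal.ofReal_mul (by positivity), hW, ENNReal.ofReal_toReal measure_ball_lt_top.ne]
  obtain ⟨lo, hi, hsum, hlo, hhi⟩ := exists_frequency_split f
    (S := Metric.ball (0 : Space N) A) measurableSet_ball measure_ball_lt_top.ne
  have hlo' : ∀ᵐ x, ‖lo x‖ ≤ t / 2 := by
    filter_upwards [hlo] with x hx
    have e : (volume (Metric.ball (0 : Space N) A)) ^ (1 / 2 : ℝ) * ‖f‖ₑ =
        ENNReal.ofReal (t / 2) := by
      rw [hvol, ENNReal.ofReal_rpow_of_nonneg (by positivity) (by norm_num), ← ofReal_norm,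
        ← ENNReal.ofReal_mul (by positivity), ← Real.sqrt_eq_rpow,
        Real.sqrt_mul (by positivity), Real.sqrt_sq (by positivity)]
      congr 1
      rw [div_mul_eq_mul_div, div_mul_eq_mul_div, div_eq_div_iff hf.ne' two_ne_zero, hc]
      ring
    rw [e, ← ofReal_norm] at hx
    exact (ENNReal.ofReal_le_ofReal_iff (by positivity)).1 hx
  have hsub : ({x | t < ‖f x‖} : Set (Space N)) ≤ᵐ[volume]
      {x | ENNReal.ofReal (t / 2) ^ 2 ≤ ‖hi x‖ₑ ^ 2} := by
    filter_upwards [hlo', hsum ▸ Lp.coeFn_add lo hi] with x hx hx2 hx3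
    have hx3 : t < ‖f x‖ := hx3
    rw [hx2, Pi.add_apply] at hx3
    change ENNReal.ofReal (t / 2) ^ 2 ≤ ‖hi x‖ₑ ^ 2
    rw [← ofReal_norm]
    have := norm_add_le (lo x) (hi x)
    gcongr
    linarith
  have hmk := mul_meas_ge_le_lintegral₀ (μ := volume) (f := fun x => ‖hi x‖ₑ ^ 2)
    ((Lp.memLp hi).1.enorm.pow_const 2) (ENNReal.ofReal (t / 2) ^ 2)
  have hset : (Metric.ball (0 : Space N) A)ᶜ = {ξ : Space N | t ≤ c * ‖ξ‖ ^ ((N : ℝ) / 2)} := by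
    ext ξ
    simp only [Set.mem_compl_iff, Metric.mem_ball, dist_zero_right, not_lt, Set.mem_ofPred_eq]
    rw [hA, ← inv_div (N : ℝ) 2, Real.rpow_inv_le_iff_of_pos (by positivity) (norm_nonneg _) (by positivity),
      div_le_iff₀' hf]
  rw [hhi, ← lintegral_indicator measurableSet_ball.compl, hset] at hmk
  refine (measure_mono_ae hsub).trans ?_
  have h4 : ENNReal.ofReal (4 * t ^ (-2 : ℝ)) = (ENNReal.ofReal (t / 2) ^ 2)⁻¹ := by
    rw [← ENNReal.ofReal_pow (by positivity), ← ENNReal.ofReal_inv_of_pos (by positivity)]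
    congr 1
    rw [Real.rpow_neg ht.le]
    norm_num
    ring
  rw [h4, mul_comm, ← div_eq_mul_inv, ENNReal.le_div_iff_mul_le (Or.inl (by positivity))
    (Or.inl (by simp)), mul_comm]
  exact hmk

/-- Layer cake with the level-dependent frequency splitting, followed by Tonelli. For fixed ξ the
level t runs up to X = c|ξ|^{N/2}, and the integral of t^{q-1} gives X^q/q. Since qN/2 = 2m, this is
a multiple of ‖f‖^q |ξ|^{2m}. -/
theorem gagliardoNirenberg_lintegral (hN : 0 < N) {m : ℕ} (hm : 1 ≤ m) :
    ∃ C : ℝ, 0 ≤ C ∧ ∀ f : Lp ℂ 2 (volume : Measure (Space N)),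
      ∫⁻ x, ENNReal.ofReal (‖f x‖ ^ (2 + 4 * m / N : ℝ)) ≤
        ENNReal.ofReal (C * ‖f‖ ^ (4 * m / N : ℝ)) *
          ∫⁻ ξ, ENNReal.ofReal (‖ξ‖ ^ (2 * m)) *
            ‖(𝓕 f : Lp ℂ 2 (volume : Measure (Space N))) ξ‖ₑ ^ 2 := by
  have hN' : (0 : ℝ) < N := by exact_mod_cast hN
  have hm' : (0 : ℝ) < m := by exact_mod_cast hm
  set q : ℝ := 4 * m / N with hq
  have hq0 : 0 < q := by positivity
  set W := (volume (Metric.ball (0 : Space N) 1)).toReal with hW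
  have hW0 : 0 < W := ENNReal.toReal_pos (Metric.measure_ball_pos _ _ one_pos).ne'
    measure_ball_lt_top.ne
  -- The factor 2 + q comes from the layer cake formula, 4 from Chebyshev at height t/2, and the
  -- rest from the inner integral in t.
  refine ⟨(2 + q) * (4 * ((2 * Real.sqrt W) ^ q / q)), by positivity, fun f => ?_⟩
  by_cases hf : f = 0
  · have h0 : ∫⁻ x, ENNReal.ofReal (‖f x‖ ^ (2 + q)) = 0 := by
      rw [← lintegral_zero (μ := (volume : Measure (Space N)))]
      refine lintegral_congr_ae ?_
      filter_upwards [Lp.coeFn_zero ℂ 2 (volume : Measure (Space N))] with x hx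
      rw [hf, hx]
      simp [Real.zero_rpow (show 2 + q ≠ 0 by positivity)]
    rw [h0]
    exact zero_le
  have hfn : 0 < ‖f‖ := norm_pos_iff.2 hf
  set c : ℝ := 2 * Real.sqrt W * ‖f‖ with hc
  have hc0 : 0 < c := by positivity
  set F : Lp ℂ 2 (volume : Measure (Space N)) := 𝓕 f with hF
  have hFm : AEMeasurable (fun ξ => ‖F ξ‖ₑ ^ 2) := (Lp.memLp F).1.enorm.pow_const 2
  rw [lintegral_rpow_eq_lintegral_meas_lt_mul volume (Eventually.of_forall fun x => norm_nonneg _)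
    (Lp.memLp f).1.norm.aemeasurable (show 0 < 2 + q by positivity)]
  have hstep : ∫⁻ t in Set.Ioi 0, volume {x | t < ‖f x‖} * ENNReal.ofReal (t ^ (2 + q - 1)) ≤
      ∫⁻ t in Set.Ioi 0, ∫⁻ ξ, {z : ℝ × Space N | z.1 ≤ c * ‖z.2‖ ^ ((N : ℝ) / 2)}.indicator
        (fun z => ENNReal.ofReal (4 * z.1 ^ (q - 1)) * ‖F z.2‖ₑ ^ 2) (t, ξ) := by
    refine setLIntegral_mono' measurableSet_Ioi fun t ht => ?_
    have ht : 0 < t := ht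
    refine (mul_le_mul' (meas_lt_norm_le hN f hc hc0 ht) le_rfl).trans (le_of_eq ?_)
    rw [mul_right_comm, ← ENNReal.ofReal_mul (by positivity), mul_assoc, ← Real.rpow_add ht,
      ← lintegral_const_mul' _ _ ENNReal.ofReal_ne_top]
    refine lintegral_congr fun ξ => ?_
    rw [show -2 + (2 + q - 1) = q - 1 by ring]
    by_cases h : t ≤ c * ‖ξ‖ ^ ((N : ℝ) / 2)
    · rw [Set.indicator_of_mem (by exact h), Set.indicator_of_mem (by exact h)]
    · rw [Set.indicator_of_notMem (by exact h), Set.indicator_of_notMem (by exact h), mul_zero]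
  refine (mul_le_mul' le_rfl hstep).trans ?_
  have hmeas : AEMeasurable (Function.uncurry fun (t : ℝ) (ξ : Space N) =>
      {z : ℝ × Space N | z.1 ≤ c * ‖z.2‖ ^ ((N : ℝ) / 2)}.indicator
        (fun z => ENNReal.ofReal (4 * z.1 ^ (q - 1)) * ‖F z.2‖ₑ ^ 2) (t, ξ))
      ((volume.restrict (Set.Ioi 0)).prod volume) := by
    refine AEMeasurable.indicator (f := fun z : ℝ × Space N =>
      ENNReal.ofReal (4 * z.1 ^ (q - 1)) * ‖F z.2‖ₑ ^ 2) ?_ ?_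
    · refine AEMeasurable.mul (by fun_prop : Measurable fun z : ℝ × Space N =>
        ENNReal.ofReal (4 * z.1 ^ (q - 1))).aemeasurable ?_
      exact hFm.comp_quasiMeasurePreserving Measure.quasiMeasurePreserving_snd
    · exact measurableSet_le (by fun_prop) (by fun_prop)
  rw [lintegral_lintegral_swap hmeas]
  have hinner : ∀ ξ : Space N, ∫⁻ t in Set.Ioi 0,
      {z : ℝ × Space N | z.1 ≤ c * ‖z.2‖ ^ ((N : ℝ) / 2)}.indicator
        (fun z => ENNReal.ofReal (4 * z.1 ^ (q - 1)) * ‖F z.2‖ₑ ^ 2) (t, ξ) =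
      ENNReal.ofReal (4 * ((2 * Real.sqrt W) ^ q / q) * ‖f‖ ^ q) *
        (ENNReal.ofReal (‖ξ‖ ^ (2 * m)) * ‖F ξ‖ₑ ^ 2) := by
    intro ξ
    set X := c * ‖ξ‖ ^ ((N : ℝ) / 2) with hX
    have hX0 : 0 ≤ X := by positivity
    have e1 : ∫⁻ t in Set.Ioi 0,
      {z : ℝ × Space N | z.1 ≤ c * ‖z.2‖ ^ ((N : ℝ) / 2)}.indicator
        (fun z => ENNReal.ofReal (4 * z.1 ^ (q - 1)) * ‖F z.2‖ₑ ^ 2) (t, ξ) =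
        ∫⁻ t in Set.Ioi 0, (Set.Iic X).indicator
          (fun t => (‖F ξ‖ₑ ^ 2 * ENNReal.ofReal 4) * ENNReal.ofReal (t ^ (q - 1))) t := by
      refine lintegral_congr fun t => ?_
      by_cases h : t ≤ X
      · rw [Set.indicator_of_mem (by exact h), Set.indicator_of_mem (by exact h),
          ENNReal.ofReal_mul (by norm_num)]
        ring
      · rw [Set.indicator_of_notMem (by exact h), Set.indicator_of_notMem (by exact h)]
    rw [e1, lintegral_indicator measurableSet_Iic, Measure.restrict_restrict measurableSet_Iic,
      Set.inter_comm, Set.Ioi_inter_Iic, lintegral_const_mul' _ _ (by finiteness),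
      lintegral_Ioc_rpow hq0 hX0]
    have e2 : X ^ q = (2 * Real.sqrt W) ^ q * ‖f‖ ^ q * ‖ξ‖ ^ (2 * m) := by
      rw [hX, hc, Real.mul_rpow (by positivity) (by positivity),
        Real.mul_rpow (by positivity) (by positivity), ← Real.rpow_mul (norm_nonneg _),
        ← Real.rpow_natCast ‖ξ‖]
      congr 2
      rw [hq]
      push_cast
      field_simp
      ring
    rw [mul_assoc, ← ENNReal.ofReal_mul (by norm_num), mul_comm, ← mul_assoc,
      ← ENNReal.ofReal_mul (by positivity), e2]
    congr 2
    ring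
  rw [lintegral_congr hinner, lintegral_const_mul' _ _ ENNReal.ofReal_ne_top, ← mul_assoc,
    ← ENNReal.ofReal_mul (by positivity)]
  refine mul_le_mul' (le_of_eq ?_) le_rfl
  congr 1
  ring

/-! ### The mass-critical exponent and the optimal constant. -/

theorem massExp_pos (N m : ℕ) : 0 < massExp N m := by
  unfold massExp
  positivity

theorem eLpNorm_massExp_eq (m : ℕ) (u : Space N → ℝ) :
    eLpNorm u (ENNReal.ofReal (massExp N m)) volume =
      (∫⁻ x, ENNReal.ofReal (|u x| ^ massExp N m)) ^ (1 / massExp N m) := by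
  have hp := massExp_pos N m
  rw [eLpNorm_eq_lintegral_rpow_enorm_toReal (by simpa using hp) ENNReal.ofReal_ne_top,
    ENNReal.toReal_ofReal hp.le]
  congr 2
  ext x
  rw [← ofReal_norm, ENNReal.ofReal_rpow_of_nonneg (norm_nonneg _) hp.le, Real.norm_eq_abs]

/-- Mass criticality: after raising to the power 2_*, the top-order seminorm appears exactly squared
and can be compared with the quadratic form. -/
theorem gnExponent_eq (hN : 0 < N) {m : ℕ} (hm : 1 ≤ m) :
    (N : ℝ) / m * (1 / 2 - 1 / massExp N m) = 2 / massExp N m := by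
  have hN' : (0 : ℝ) < N := by exact_mod_cast hN
  have hm' : (0 : ℝ) < m := by exact_mod_cast hm
  have hp := massExp_pos N m
  field_simp
  unfold massExp
  field_simp
  ring

/-- The right-hand side of the Gagliardo–Nirenberg inequality, raised to the power `2_*`. -/
theorem gnRhs_rpow (hN : 0 < N) {m : ℕ} (hm : 1 ≤ m) {C a b : ℝ} (hC : 0 ≤ C) (ha : 0 ≤ a)
    (hb : 0 ≤ b) :
    (C * Real.sqrt a ^ ((N : ℝ) / m * (1 / 2 - 1 / massExp N m)) *
      Real.sqrt b ^ (1 - (N : ℝ) / m * (1 / 2 - 1 / massExp N m))) ^ massExp N m =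
      C ^ massExp N m * a * b ^ (2 * (m : ℝ) / N) := by
  have hp := massExp_pos N m
  have hN' : (0 : ℝ) < N := by exact_mod_cast hN
  rw [gnExponent_eq hN hm, Real.mul_rpow (by positivity) (by positivity),
    Real.mul_rpow (by positivity) (by positivity), ← Real.rpow_mul (by positivity),
    ← Real.rpow_mul (by positivity), div_mul_cancel₀ _ hp.ne', Real.rpow_two, Real.sq_sqrt ha,
    Real.sqrt_eq_rpow b, ← Real.rpow_mul hb]
  congr 2
  rw [sub_mul, div_mul_cancel₀ _ hp.ne', massExp]
  field_simp
  ring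

theorem MemH.lintegral_l2Fourier_eq {m : ℕ} {u : Space N → ℝ} (h : MemH m u) :
    ENNReal.ofReal ((2 * Real.pi) ^ (2 * m)) *
      ∫⁻ ξ, ENNReal.ofReal (‖ξ‖ ^ (2 * m)) * ‖Polyharmonic.l2Fourier u ξ‖ₑ ^ 2 =
      ENNReal.ofReal (∫ x, polyGradSq m u x) := by
  obtain ⟨hint, heq⟩ := h.integral_polyGradSq_eq
  rw [heq, ofReal_integral_eq_lintegral_ofReal hint (Eventually.of_forall fun ξ => by positivity),
    ← lintegral_const_mul' _ _ ENNReal.ofReal_ne_top]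
  refine lintegral_congr fun ξ => ?_
  rw [← ofReal_norm, ← ENNReal.ofReal_pow (norm_nonneg _), ← ENNReal.ofReal_mul (by positivity),
    ← ENNReal.ofReal_mul (by positivity), mul_pow (2 * Real.pi), mul_assoc]

theorem exists_gagliardoNirenberg_rpow (hN : 0 < N) {m : ℕ} (hm : 1 ≤ m) :
    ∃ C : ℝ, 0 ≤ C ∧ ∀ u : Space N → ℝ, MemH m u →
      ∫⁻ x, ENNReal.ofReal (|u x| ^ massExp N m) ≤ ENNReal.ofReal
        (C * (∫ x, polyGradSq m u x) * (∫ x, u x ^ 2) ^ (2 * (m : ℝ) / N)) := by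
  obtain ⟨C, hC, hGN⟩ := gagliardoNirenberg_lintegral hN hm
  refine ⟨C * ((2 * Real.pi) ^ (2 * m))⁻¹, by positivity, fun u hu => ?_⟩
  have hu2 := hu.memLp
  set f : Lp ℂ 2 (volume : Measure (Space N)) := (hu2.ofReal (K := ℂ)).toLp _ with hf
  have hfu : f =ᵐ[volume] fun x => (u x : ℂ) := MemLp.coeFn_toLp _
  have h1 : ∫⁻ x, ENNReal.ofReal (|u x| ^ massExp N m) =
      ∫⁻ x, ENNReal.ofReal (‖f x‖ ^ (2 + 4 * m / N : ℝ)) := by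
    refine lintegral_congr_ae ?_
    filter_upwards [hfu] with x hx
    rw [hx, Complex.norm_real, Real.norm_eq_abs]
    rfl
  have h2 : ‖f‖ ^ 2 = ∫ x, u x ^ 2 := by
    rw [← integral_norm_sq_eq_norm_sq]
    refine integral_congr_ae ?_
    filter_upwards [hfu] with x hx
    rw [hx, Complex.norm_real, Real.norm_eq_abs, sq_abs]
  have h3 : ‖f‖ ^ (4 * m / N : ℝ) = (∫ x, u x ^ 2) ^ (2 * (m : ℝ) / N) := by
    rw [← h2, ← Real.rpow_two, ← Real.rpow_mul (norm_nonneg _)]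
    congr 1
    ring
  have h4 : ∫⁻ ξ, ENNReal.ofReal (‖ξ‖ ^ (2 * m)) *
      ‖(𝓕 f : Lp ℂ 2 (volume : Measure (Space N))) ξ‖ₑ ^ 2 =
      ENNReal.ofReal (((2 * Real.pi) ^ (2 * m))⁻¹ * ∫ x, polyGradSq m u x) := by
    rw [ENNReal.ofReal_mul (by positivity), ← hu.lintegral_l2Fourier_eq, ← mul_assoc,
      ← ENNReal.ofReal_mul (by positivity), inv_mul_cancel₀ (by positivity), ENNReal.ofReal_one,
      one_mul, l2Fourier_eq hu2]
  rw [h1]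
  refine (hGN f).trans (le_of_eq ?_)
  rw [h3, h4, ← ENNReal.ofReal_mul (by positivity)]
  congr 1
  ring

/-- The admissible constants form a closed set bounded below, so their infimum is admissible as soon
as the set is nonempty. Nonemptiness is the Gagliardo–Nirenberg inequality itself; for an empty set
the infimum would be the meaningless value 0. -/
theorem gnConst_spec (hN : 0 < N) {m : ℕ} (hm : 1 ≤ m) :
    0 ≤ gnConst N m (massExp N m) ∧ ∀ u : Space N → ℝ, MemH m u →
    eLpNorm u (ENNReal.ofReal (massExp N m)) volume ≤ ENNReal.ofReal
      (gnConst N m (massExp N m) *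
        Real.sqrt (∫ x, polyGradSq m u x) ^ ((N : ℝ) / m * (1 / 2 - 1 / massExp N m))
        * Real.sqrt (∫ x, u x ^ 2) ^ (1 - (N : ℝ) / m * (1 / 2 - 1 / massExp N m))) := by
  have hp := massExp_pos N m
  have hpoly : ∀ u : Space N → ℝ, 0 ≤ ∫ x, polyGradSq m u x := fun u =>
    integral_nonneg (polyGradSq_nonneg m u)
  have hsq : ∀ u : Space N → ℝ, 0 ≤ ∫ x, u x ^ 2 := fun u => integral_nonneg fun x => sq_nonneg _
  let S : Set ℝ := {C : ℝ | 0 ≤ C ∧ ∀ u : Space N → ℝ, MemH m u →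
    eLpNorm u (ENNReal.ofReal (massExp N m)) volume ≤ ENNReal.ofReal
      (C * Real.sqrt (∫ x, polyGradSq m u x) ^ ((N : ℝ) / m * (1 / 2 - 1 / massExp N m))
        * Real.sqrt (∫ x, u x ^ 2) ^ (1 - (N : ℝ) / m * (1 / 2 - 1 / massExp N m)))}
  change sInf S ∈ S
  have hclosed : IsClosed S := by
    have : S = Set.Ici 0 ∩ ⋂ (u : Space N → ℝ) (_ : MemH m u), {C : ℝ |
      eLpNorm u (ENNReal.ofReal (massExp N m)) volume ≤ ENNReal.ofReal
      (C * Real.sqrt (∫ x, polyGradSq m u x) ^ ((N : ℝ) / m * (1 / 2 - 1 / massExp N m))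
        * Real.sqrt (∫ x, u x ^ 2) ^ (1 - (N : ℝ) / m * (1 / 2 - 1 / massExp N m)))} := by
      ext C
      simp [S]
    rw [this]
    refine isClosed_Ici.inter (isClosed_iInter fun u => isClosed_iInter fun _ => ?_)
    exact isClosed_le continuous_const (ENNReal.continuous_ofReal.comp (by fun_prop))
  refine hclosed.csInf_mem ?_ ⟨0, fun C hC => hC.1⟩
  obtain ⟨C, hC, hGN⟩ := exists_gagliardoNirenberg_rpow hN hm
  refine ⟨C ^ (1 / massExp N m), by positivity, fun u hu => ?_⟩
  rw [eLpNorm_massExp_eq]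
  refine (ENNReal.rpow_le_rpow (hGN u hu) (by positivity)).trans (le_of_eq ?_)
  have h1 := gnRhs_rpow hN hm (show 0 ≤ C ^ (1 / massExp N m) by positivity) (hpoly u) (hsq u)
  rw [← Real.rpow_mul hC, one_div_mul_cancel hp.ne', Real.rpow_one] at h1
  rw [← h1, ENNReal.ofReal_rpow_of_nonneg (by positivity) (by positivity),
    ← Real.rpow_mul (by positivity), mul_one_div_cancel hp.ne', Real.rpow_one]

/-- The Gagliardo–Nirenberg inequality with its optimal constant. -/
theorem MemH.gagliardoNirenberg (hN : 0 < N) {m : ℕ} (hm : 1 ≤ m) {u : Space N → ℝ}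
    (hu : MemH m u) :
    Integrable (fun x => |u x| ^ massExp N m) ∧
      ∫ x, |u x| ^ massExp N m ≤ gnConst N m (massExp N m) ^ massExp N m *
        (∫ x, polyGradSq m u x) * (∫ x, u x ^ 2) ^ (2 * (m : ℝ) / N) := by
  have hp := massExp_pos N m
  have hpoly : 0 ≤ ∫ x, polyGradSq m u x := integral_nonneg (polyGradSq_nonneg m u)
  have hsq : 0 ≤ ∫ x, u x ^ 2 := integral_nonneg fun x => sq_nonneg _
  obtain ⟨hC, hGN⟩ := gnConst_spec hN hm
  have h1 := ENNReal.rpow_le_rpow (hGN u hu) hp.le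
  rw [eLpNorm_massExp_eq, ← ENNReal.rpow_mul, one_div_mul_cancel hp.ne', ENNReal.rpow_one,
    ENNReal.ofReal_rpow_of_nonneg (by positivity) hp.le, gnRhs_rpow hN hm hC hpoly hsq] at h1
  have hnn : ∀ x, 0 ≤ |u x| ^ massExp N m := fun x => by positivity
  have hmeas : AEStronglyMeasurable (fun x => |u x| ^ massExp N m) volume := by
    have := hu.memLp.1
    exact (this.norm.aemeasurable.pow_const _).aestronglyMeasurable
  have hint : Integrable (fun x => |u x| ^ massExp N m) := by
    refine ⟨hmeas, ?_⟩
    rw [hasFiniteIntegral_iff_ofReal (Eventually.of_forall hnn)]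
    exact h1.trans_lt ENNReal.ofReal_lt_top
  refine ⟨hint, ?_⟩
  rw [← ofReal_integral_eq_lintegral_ofReal hint (Eventually.of_forall hnn)] at h1
  exact (ENNReal.ofReal_le_ofReal_iff (by positivity)).1 h1

end

section

open scoped FourierTransform LineDeriv SchwartzMap

variable {N : ℕ}

/-! ### Smooth approximation in `H^1` -/

theorem lintegral_schwartz_sub_eq_fourier (φ : 𝓢(Space N, ℂ))
    (f : Lp ℂ 2 (volume : Measure (Space N))) :
    ∫⁻ x, ‖φ x - f x‖ₑ ^ 2 =
      ∫⁻ ξ, ‖(𝓕 φ) ξ - (𝓕 f : Lp ℂ 2 (volume : Measure (Space N))) ξ‖ₑ ^ 2 := by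
  have h1 : ∫⁻ x, ‖φ x - f x‖ₑ ^ 2 = ‖φ.toLp 2 volume - f‖ₑ ^ 2 := by
    rw [← lintegral_enorm_sq_eq]
    refine lintegral_congr_ae ?_
    filter_upwards [φ.coeFn_toLp 2 volume, Lp.coeFn_sub (φ.toLp 2 volume) f] with x a b
    rw [b, Pi.sub_apply, a]
  have h2 : ∫⁻ ξ, ‖(𝓕 φ) ξ - (𝓕 f : Lp ℂ 2 (volume : Measure (Space N))) ξ‖ₑ ^ 2 =
      ‖𝓕 (φ.toLp 2 volume) - 𝓕 f‖ₑ ^ 2 := by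
    rw [← lintegral_enorm_sq_eq, SchwartzMap.toLp_fourier_eq]
    refine lintegral_congr_ae ?_
    filter_upwards [(𝓕 φ).coeFn_toLp 2 volume, Lp.coeFn_sub ((𝓕 φ).toLp 2 volume) (𝓕 f)] with x a b
    rw [b, Pi.sub_apply, a]
  have h3 : 𝓕 (φ.toLp 2 volume) - 𝓕 f = 𝓕 (φ.toLp 2 volume - f) :=
    (map_sub (Lp.fourierTransformₗᵢ (Space N) ℂ) _ _).symm
  rw [h1, h2, h3, ← ofReal_norm, ← ofReal_norm, Lp.norm_fourier_eq]

theorem lintegral_schwartz_sub_real_eq_fourier (φ : 𝓢(Space N, ℂ)) {u : Space N → ℝ}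
    (hu : MemLp u 2 volume) :
    ∫⁻ x, ‖φ x - (u x : ℂ)‖ₑ ^ 2 = ∫⁻ ξ, ‖(𝓕 φ) ξ - l2Fourier u ξ‖ₑ ^ 2 := by
  rw [l2Fourier_eq hu, ← lintegral_schwartz_sub_eq_fourier]
  refine lintegral_congr_ae ?_
  filter_upwards [(hu.ofReal (K := ℂ)).coeFn_toLp] with x hx
  rw [hx]
  rfl

theorem abs_apply_le_norm (ξ : Space N) (i : Fin N) : |ξ i| ≤ ‖ξ‖ := by
  simpa using PiLp.norm_apply_le ξ i

/-- On the Fourier side H¹ is a weighted L² space: (1+|ξ|²)^{1/2}û is approximated in L² by a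
Schwartz function, and the weight is divided out again. The inverse weight σ satisfies σ ≤ 1 and
|ξ_i|σ ≤ 1, so this one approximation controls u and all its first derivatives. -/
theorem MemH.exists_schwartz_approx {u : Space N → ℝ} (hu : MemH 1 u) {δ : ℝ≥0∞} (hδ : δ ≠ 0) :
    ∃ φ : 𝓢(Space N, ℂ), ∫⁻ x, ‖φ x - (u x : ℂ)‖ₑ ^ 2 ≤ δ ∧
      ∀ i : Fin N, ∫⁻ x, ‖(∂_{(EuclideanSpace.single i 1 : Space N)} φ) x -
        (Polyharmonic.weakPartial i u x : ℂ)‖ₑ ^ 2 ≤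
          ENNReal.ofReal (2 * Real.pi) ^ 2 * δ := by
  have hu2 : MemLp u 2 volume := hu.memLp
  have hder : ∀ i : Fin N, l2Fourier (Polyharmonic.weakPartial i u) =ᵐ[volume] _ := fun i =>
    (MemH.hasWeakPartial (k := 0) hu i).l2Fourier hu2 (hu.weakPartial (k := 0) i).memLp
  let σ : Space N → ℝ := fun ξ => (1 + ‖ξ‖ ^ 2) ^ (-(1 / 2) : ℝ)
  have hσ0 : ∀ ξ, 0 < σ ξ := fun ξ => by positivity
  have hσsq : ∀ ξ, σ ξ ^ 2 = (1 + ‖ξ‖ ^ 2)⁻¹ := fun ξ => by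
    simp only [σ]
    rw [← Real.rpow_natCast, ← Real.rpow_mul (by positivity)]
    norm_num [Real.rpow_neg_one]
  have hσ1 : ∀ ξ, σ ξ ≤ 1 := fun ξ => by
    have : σ ξ ^ 2 ≤ 1 := by rw [hσsq]; exact inv_le_one_of_one_le₀ (by nlinarith [norm_nonneg ξ])
    nlinarith [hσ0 ξ]
  have hσξ : ∀ ξ i, |ξ i| * σ ξ ≤ 1 := fun ξ i => by
    have h1 : (‖ξ‖ * σ ξ) ^ 2 ≤ 1 := by
      rw [mul_pow, hσsq, ← div_eq_mul_inv]
      exact div_le_one_of_le₀ (by linarith) (by positivity)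
    have h2 : ‖ξ‖ * σ ξ ≤ 1 := by nlinarith [mul_nonneg (norm_nonneg ξ) (hσ0 ξ).le]
    exact (mul_le_mul_of_nonneg_right (abs_apply_le_norm ξ i) (hσ0 ξ).le).trans h2
  have hσt : Function.HasTemperateGrowth fun ξ : Space N => (σ ξ : ℂ) := by
    simp only [σ]
    fun_prop
  have hσc : Continuous σ := by
    have : Continuous fun ξ : Space N => 1 + ‖ξ‖ ^ 2 := by fun_prop
    exact this.rpow_const fun ξ => Or.inl (by positivity)
  let w : Space N → ℂ := fun ξ => ((σ ξ)⁻¹ : ℝ) * l2Fourier u ξ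
  have hwm : AEStronglyMeasurable w volume :=
    (Complex.continuous_ofReal.comp (hσc.inv₀ fun ξ => (hσ0 ξ).ne')).aestronglyMeasurable.mul
      (memLp_l2Fourier u).1
  have hw : MemLp w 2 volume := by
    rw [memLp_two_iff_integrable_sq_norm hwm]
    have h1 : Integrable fun ξ => ‖l2Fourier u ξ‖ ^ 2 :=
      (memLp_l2Fourier u).integrable_norm_pow (by norm_num)
    have h2 := (MemH.integral_polyGradSq_eq (m := 1) hu).1
    refine (h1.add (h2.const_mul (((2 * Real.pi) ^ 2)⁻¹))).congr (Eventually.of_forall fun ξ => ?_)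
    simp only [w, Pi.add_apply]
    rw [norm_mul, mul_pow ‖_‖, Complex.norm_real, Real.norm_eq_abs, sq_abs, inv_pow, hσsq, inv_inv]
    field_simp
    ring
  obtain ⟨h, hh⟩ : ∃ h : 𝓢(Space N, ℂ), ∫⁻ ξ, ‖h ξ - w ξ‖ₑ ^ 2 ≤ δ := by
    have hdense := SchwartzMap.denseRange_toLpCLM (F := ℂ) (p := 2) ENNReal.ofNat_ne_top
      (μ := (volume : Measure (Space N)))
    obtain ⟨δ', hδ'0, hδ'⟩ : ∃ δ' : ℝ, 0 < δ' ∧ ENNReal.ofReal δ' ^ 2 ≤ δ := by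
      rcases eq_or_ne δ ⊤ with rfl | ht
      · exact ⟨1, one_pos, le_top⟩
      · refine ⟨Real.sqrt δ.toReal, Real.sqrt_pos.2 (ENNReal.toReal_pos hδ ht), ?_⟩
        rw [← ENNReal.ofReal_pow (Real.sqrt_nonneg _), Real.sq_sqrt ENNReal.toReal_nonneg,
          ENNReal.ofReal_toReal ht]
    obtain ⟨h, hd⟩ := hdense.exists_dist_lt (hw.toLp w) hδ'0
    refine ⟨h, le_trans ?_ hδ'⟩
    have e : ∫⁻ ξ, ‖h ξ - w ξ‖ₑ ^ 2 = ‖h.toLp 2 volume - hw.toLp w‖ₑ ^ 2 := by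
      rw [← lintegral_enorm_sq_eq]
      refine lintegral_congr_ae ?_
      filter_upwards [h.coeFn_toLp 2 volume, Lp.coeFn_sub (h.toLp 2 volume) (hw.toLp w), hw.coeFn_toLp]
        with x a b c
      rw [b, Pi.sub_apply, a, c]
    rw [e, ← ofReal_norm, ← dist_eq_norm, dist_comm]
    exact pow_le_pow_left' (ENNReal.ofReal_le_ofReal hd.le) 2
  -- Since σ is smooth of temperate growth, κ is again Schwartz; its inverse transform is the
  -- approximation.
  let κ : 𝓢(Space N, ℂ) := SchwartzMap.smulLeftCLM ℂ (fun ξ : Space N => (σ ξ : ℂ)) h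
  have hκ : ∀ ξ, κ ξ = (σ ξ : ℂ) * h ξ := fun ξ => SchwartzMap.smulLeftCLM_apply_apply hσt h ξ
  have hFκ : 𝓕 (𝓕⁻ κ) = κ := FourierTransform.fourier_fourierInv_eq κ
  have hwσ : ∀ ξ, l2Fourier u ξ = (σ ξ : ℂ) * w ξ := fun ξ => by
    simp only [w]
    rw [← mul_assoc, ← Complex.ofReal_mul, mul_inv_cancel₀ (hσ0 ξ).ne', Complex.ofReal_one, one_mul]
  refine ⟨𝓕⁻ κ, ?_, fun i => ?_⟩
  · rw [lintegral_schwartz_sub_real_eq_fourier _ hu2, hFκ]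
    refine le_trans (lintegral_mono fun ξ => ?_) hh
    rw [hκ, hwσ, ← mul_sub, enorm_mul]
    have : ‖(σ ξ : ℂ)‖ₑ ≤ 1 := by
      rw [← ofReal_norm, Complex.norm_real, Real.norm_of_nonneg (hσ0 ξ).le]
      simpa using hσ1 ξ
    exact pow_le_pow_left' (mul_le_of_le_one_left zero_le this) 2
  · rw [lintegral_schwartz_sub_real_eq_fourier _ (hu.weakPartial (k := 0) i).memLp,
      SchwartzMap.fourier_lineDerivOp_eq, hFκ]
    refine le_trans ?_ (mul_le_mul' le_rfl hh)
    rw [← lintegral_const_mul' _ _ (by finiteness)]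
    refine lintegral_mono_ae ?_
    filter_upwards [hder i] with ξ hξ
    have htg : Function.HasTemperateGrowth
        (fun x : Space N => (inner ℝ x (EuclideanSpace.single i 1 : Space N) : ℝ)) := by fun_prop
    rw [hξ]
    have e1 : ((2 * Real.pi * Complex.I : ℂ) • (SchwartzMap.smulLeftCLM ℂ
        (fun x : Space N => (inner ℝ x (EuclideanSpace.single i 1 : Space N) : ℝ))) κ) ξ =
        (2 * Real.pi * Complex.I) * ((ξ i : ℂ) * (σ ξ * h ξ)) := by
      rw [smul_apply, SchwartzMap.smulLeftCLM_apply_apply htg, hκ]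
      simp [EuclideanSpace.inner_single_right]
    rw [e1, hwσ]
    have e2 : (2 * Real.pi * Complex.I) * ((ξ i : ℂ) * (σ ξ * h ξ)) -
        2 * Real.pi * Complex.I * (ξ i : ℂ) * ((σ ξ : ℂ) * w ξ) =
        (2 * Real.pi * Complex.I) * (((ξ i * σ ξ : ℝ) : ℂ) * (h ξ - w ξ)) := by
      push_cast
      ring
    rw [e2, enorm_mul, enorm_mul (_ : ℂ) (h ξ - w ξ), mul_pow]
    have e3 : ‖(2 * Real.pi * Complex.I : ℂ)‖ₑ = ENNReal.ofReal (2 * Real.pi) := by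
      rw [← ofReal_norm]
      congr 1
      simp [abs_of_pos Real.pi_pos]
    have e4 : ‖((ξ i * σ ξ : ℝ) : ℂ)‖ₑ ≤ 1 := by
      rw [← ofReal_norm, Complex.norm_real, Real.norm_eq_abs, abs_mul, abs_of_pos (hσ0 ξ)]
      exact ENNReal.ofReal_le_one.2 (hσξ ξ i)
    rw [e3]
    gcongr
    exact mul_le_of_le_one_left zero_le e4

theorem MemH.exists_smooth_approx {u : Space N → ℝ} (hu : MemH 1 u) {δ : ℝ} (hδ : 0 < δ) :
    ∃ f : Space N → ℝ, ContDiff ℝ ∞ f ∧ MemLp f 2 volume ∧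
      (∀ i, MemLp (partialDeriv i f) 2 volume) ∧ ∫ x, (f x - u x) ^ 2 ≤ δ ∧
      ∀ i, ∫ x, (partialDeriv i f x - Polyharmonic.weakPartial i u x) ^ 2 ≤ δ := by
  have hπ : 1 ≤ (2 * Real.pi) ^ 2 := by nlinarith [Real.pi_gt_three]
  -- Compensates for the factor (2π)² lost on the derivatives.
  set δ' : ℝ := δ / (2 * Real.pi) ^ 2 with hδ'
  have hδ'0 : 0 < δ' := by positivity
  obtain ⟨φ, h1, h2⟩ := hu.exists_schwartz_approx (δ := ENNReal.ofReal δ') (by simpa using hδ'0)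
  have hd : ∀ i x, partialDeriv i (fun y => (φ y).re) x =
      ((∂_{(EuclideanSpace.single i 1 : Space N)} φ) x).re := fun i x => by
    rw [SchwartzMap.lineDerivOp_apply_eq_fderiv]
    exact partialDeriv_clm_comp φ.differentiableAt Complex.reCLM i
  have hφ2 : MemLp (fun y => (φ y).re) 2 volume := (φ.memLp 2).re
  have hdφ2 : ∀ i, MemLp (partialDeriv i (fun y => (φ y).re)) 2 volume := fun i => by
    rw [funext (hd i)]
    exact ((∂_{(EuclideanSpace.single i 1 : Space N)} φ).memLp 2).re
  have key : ∀ {z : Space N → ℂ} {v : Space N → ℝ}, MemLp (fun x => (z x).re) 2 volume →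
      MemLp v 2 volume → ∫⁻ x, ‖z x - (v x : ℂ)‖ₑ ^ 2 ≤ ENNReal.ofReal δ →
      ∫ x, ((z x).re - v x) ^ 2 ≤ δ := by
    intro z v hz hv hzv
    have hint : Integrable fun x => ((z x).re - v x) ^ 2 := (hz.sub hv).integrable_sq
    have h3 : ENNReal.ofReal (∫ x, ((z x).re - v x) ^ 2) ≤ ENNReal.ofReal δ := by
      rw [ofReal_integral_eq_lintegral_ofReal hint (Eventually.of_forall fun x => sq_nonneg _)]
      refine le_trans (lintegral_mono fun x => ?_) hzv
      rw [← ofReal_norm, ← ENNReal.ofReal_pow (norm_nonneg _)]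
      refine ENNReal.ofReal_le_ofReal (sq_le_sq' ?_ ?_)
      · have := Complex.abs_re_le_norm (z x - v x)
        rw [Complex.sub_re, Complex.ofReal_re] at this
        exact (abs_le.1 this).1
      · have := Complex.abs_re_le_norm (z x - v x)
        rw [Complex.sub_re, Complex.ofReal_re] at this
        exact (abs_le.1 this).2
    exact (ENNReal.ofReal_le_ofReal_iff hδ.le).1 h3
  refine ⟨fun y => (φ y).re, Complex.reCLM.contDiff.comp (φ.smooth ⊤), hφ2, hdφ2, ?_, fun i => ?_⟩
  · refine key hφ2 hu.memLp (h1.trans (ENNReal.ofReal_le_ofReal ?_))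
    exact div_le_self hδ.le hπ
  · simp only [hd]
    refine key ?_ (hu.weakPartial (k := 0) i).memLp ((h2 i).trans (le_of_eq ?_))
    · exact (funext (hd i)) ▸ hdφ2 i
    · rw [← ENNReal.ofReal_pow (by positivity), ← ENNReal.ofReal_mul (by positivity), hδ']
      congr 1
      field_simp

end

section

variable {N : ℕ}

/-! ### Weighted Hardy inequalities -/

/-- The square of `|y|`. -/
def ySq {N : ℕ} (K : ℕ) (x : Space N) : ℝ := ∑ i : Fin N with i.val < K, x i ^ 2

theorem ySq_nonneg (K : ℕ) (x : Space N) : 0 ≤ ySq K x := Finset.sum_nonneg fun _ _ => sq_nonneg _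

theorem yNorm_pow_two_mul (K m : ℕ) (x : Space N) : yNorm K x ^ (2 * m) = ySq K x ^ m := by
  rw [pow_mul, yNorm, ← ySq, Real.sq_sqrt (ySq_nonneg K x)]

/-- The regularized weight `(|y|^2 + ε)⁻¹`. -/
def regWeight {N : ℕ} (K : ℕ) (ε : ℝ) (x : Space N) : ℝ := (ySq K x + ε)⁻¹

theorem regWeight_pos (K : ℕ) {ε : ℝ} (hε : 0 < ε) (x : Space N) : 0 < regWeight K ε x :=
  inv_pos.2 (add_pos_of_nonneg_of_pos (ySq_nonneg K x) hε)

theorem regWeight_le (K : ℕ) {ε : ℝ} (hε : 0 < ε) (x : Space N) : regWeight K ε x ≤ ε⁻¹ :=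
  inv_anti₀ hε (le_add_of_nonneg_left (ySq_nonneg K x))

theorem regWeight_pow_le (K k : ℕ) {ε : ℝ} (hε : 0 < ε) (x : Space N) :
    regWeight K ε x ^ k ≤ ε⁻¹ ^ k :=
  pow_le_pow_left₀ (regWeight_pos K hε x).le (regWeight_le K hε x) k

theorem ySq_mul_regWeight_le (K : ℕ) {ε : ℝ} (hε : 0 < ε) (x : Space N) :
    ySq K x * regWeight K ε x ≤ 1 := by
  rw [regWeight, ← div_eq_mul_inv]
  exact div_le_one_of_le₀ (by linarith) (by linarith [ySq_nonneg K x])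

theorem continuous_ySq (K : ℕ) : Continuous (ySq K : Space N → ℝ) := by
  unfold ySq
  fun_prop

theorem continuous_regWeight (K : ℕ) {ε : ℝ} (hε : 0 < ε) :
    Continuous (regWeight K ε : Space N → ℝ) :=
  ((continuous_ySq K).add continuous_const).inv₀ fun x =>
    (add_pos_of_nonneg_of_pos (ySq_nonneg K x) hε).ne'

theorem sq_apply_le_ySq {K : ℕ} {i : Fin N} (hi : i.val < K) (x : Space N) :
    x i ^ 2 ≤ ySq K x :=
  Finset.single_le_sum (f := fun i : Fin N => x i ^ 2) (fun _ _ => sq_nonneg _) (by simp [hi])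

theorem abs_apply_mul_regWeight_le {K : ℕ} {i : Fin N} (hi : i.val < K) {ε : ℝ} (hε : 0 < ε)
    (x : Space N) : |x i| * regWeight K ε x ≤ 1 + ε⁻¹ := by
  have h1 : |x i| ≤ 1 + ySq K x := by
    have := sq_apply_le_ySq hi x
    nlinarith [sq_abs (x i), sq_nonneg (|x i| - 1)]
  calc |x i| * regWeight K ε x ≤ (1 + ySq K x) * regWeight K ε x :=
        mul_le_mul_of_nonneg_right h1 (regWeight_pos K hε x).le
    _ ≤ 1 + ε⁻¹ := by
        have := ySq_mul_regWeight_le K hε x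
        have := regWeight_le K hε x
        linarith

theorem contDiff_apply_coord (i : Fin N) : ContDiff ℝ ∞ (fun x : Space N => x i) :=
  (EuclideanSpace.proj i : Space N →L[ℝ] ℝ).contDiff

theorem contDiff_ySq (K : ℕ) : ContDiff ℝ ∞ (ySq K : Space N → ℝ) := by
  unfold ySq
  exact ContDiff.sum fun i _ => (contDiff_apply_coord i).pow 2

theorem contDiff_regWeight (K : ℕ) {ε : ℝ} (hε : 0 < ε) :
    ContDiff ℝ ∞ (regWeight K ε : Space N → ℝ) :=
  ((contDiff_ySq K).add contDiff_const).inv fun x => by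
    have := ySq_nonneg K x
    positivity

/-- The components `y_i (|y|^2 + ε)^{-(k+1)}` of the vector field of the Hardy inequality. -/
theorem partialDeriv_apply_mul_regWeight_pow {K : ℕ} {i : Fin N} (hi : i.val < K) {ε : ℝ}
    (hε : 0 < ε) (k : ℕ) (x : Space N) :
    partialDeriv i (fun x => x i * regWeight K ε x ^ (k + 1)) x =
      regWeight K ε x ^ (k + 1) - 2 * (k + 1) * (x i ^ 2 * regWeight K ε x ^ (k + 2)) := by
  have hx : ∀ j : Fin N, HasFDerivAt (fun x : Space N => x j)
      (EuclideanSpace.proj j : Space N →L[ℝ] ℝ) x := fun j =>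
    (EuclideanSpace.proj j : Space N →L[ℝ] ℝ).hasFDerivAt
  have hne : ySq K x + ε ≠ 0 := by
    have := ySq_nonneg K x
    positivity
  have hS : HasFDerivAt (ySq K : Space N → ℝ)
      (∑ j : Fin N with j.val < K, (2 * x j) • (EuclideanSpace.proj j : Space N →L[ℝ] ℝ)) x := by
    unfold ySq
    refine HasFDerivAt.fun_sum fun j _ => ?_
    convert! (hx j).pow 2 using 1
    simp
  have hw : HasFDerivAt (fun x : Space N => regWeight K ε x) _ x :=
    (hasDerivAt_inv hne).comp_hasFDerivAt x (hS.add_const ε)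
  have hV := (hx i).mul (hw.pow (k + 1))
  have h3 : (∑ j : Fin N with j.val < K, (2 * x j) • (EuclideanSpace.proj j : Space N →L[ℝ] ℝ))
      (EuclideanSpace.single i 1) = 2 * x i := by
    rw [sum_apply]
    rw [Finset.sum_eq_single_of_mem i (by simp [hi])]
    · simp
    · intro j _ hj
      simp [hj]
  unfold partialDeriv
  rw [show (fun x : Space N => x i * regWeight K ε x ^ (k + 1)) =
    ((fun x : Space N => x i) * fun x => regWeight K ε x ^ (k + 1)) from rfl, hV.fderiv]
  simp only [add_apply, smul_apply, h3, smul_eq_mul]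
  simp [regWeight]
  field_simp
  ring

theorem contDiff_apply_mul_regWeight_pow (K : ℕ) (i : Fin N) {ε : ℝ} (hε : 0 < ε) (k : ℕ) :
    ContDiff ℝ ∞ (fun x : Space N => x i * regWeight K ε x ^ (k + 1)) :=
  (contDiff_apply_coord i).mul ((contDiff_regWeight K hε).pow _)

theorem continuous_partialDeriv {f : Space N → ℝ} (hf : ContDiff ℝ ∞ f) (i : Fin N) :
    Continuous (partialDeriv i f) :=
  (hf.continuous_fderiv (by simp)).clm_apply continuous_const

theorem abs_apply_mul_regWeight_pow_le {K : ℕ} {i : Fin N} (hi : i.val < K) {ε : ℝ} (hε : 0 < ε)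
    (k : ℕ) (x : Space N) :
    |x i * regWeight K ε x ^ (k + 1)| ≤ (1 + ε⁻¹) * ε⁻¹ ^ k := by
  have hw := regWeight_pos K hε x
  rw [pow_succ', ← mul_assoc, abs_mul, abs_mul, abs_of_pos hw, abs_of_pos (pow_pos hw k)]
  exact mul_le_mul (abs_apply_mul_regWeight_le hi hε x) (regWeight_pow_le K k hε x)
    (pow_pos hw k).le (by positivity)

theorem abs_partialDeriv_apply_mul_regWeight_pow_le {K : ℕ} {i : Fin N} (hi : i.val < K) {ε : ℝ}
    (hε : 0 < ε) (k : ℕ) (x : Space N) :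
    |partialDeriv i (fun x => x i * regWeight K ε x ^ (k + 1)) x| ≤
      (1 + 2 * (k + 1)) * ε⁻¹ ^ (k + 1) := by
  have hw := regWeight_pos K hε x
  have h1 := regWeight_pow_le K (k + 1) hε x
  have h2 : x i ^ 2 * regWeight K ε x ^ (k + 2) ≤ ε⁻¹ ^ (k + 1) := by
    rw [pow_succ' _ (k + 1), ← mul_assoc]
    have h3 : x i ^ 2 * regWeight K ε x ≤ 1 :=
      (mul_le_mul_of_nonneg_right (sq_apply_le_ySq hi x) hw.le).trans (ySq_mul_regWeight_le K hε x)
    exact (mul_le_of_le_one_left (pow_pos hw _).le h3).trans h1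
  have h4 : 0 ≤ x i ^ 2 * regWeight K ε x ^ (k + 2) := by positivity
  have h5 : 0 < regWeight K ε x ^ (k + 1) := by positivity
  rw [partialDeriv_apply_mul_regWeight_pow hi hε, abs_le]
  have hk : (0 : ℝ) ≤ 2 * (k + 1) := by positivity
  constructor <;> nlinarith [mul_le_mul_of_nonneg_left h2 hk, mul_nonneg hk h4]

theorem integrable_mul_regWeight_pow {F : Space N → ℝ} (hF : Integrable F) (K : ℕ) {ε : ℝ}
    (hε : 0 < ε) (k : ℕ) : Integrable (fun x => F x * regWeight K ε x ^ k) := by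
  refine hF.mul_bdd (c := ε⁻¹ ^ k) ((continuous_regWeight K hε).pow k).aestronglyMeasurable
    (Eventually.of_forall fun x => ?_)
  rw [Real.norm_of_nonneg (pow_pos (regWeight_pos K hε x) k).le]
  exact regWeight_pow_le K k hε x

/-- Integrate f² against the divergence of V = y(|y|²+ε)^{-(k+1)}, which is at least
(K-2k-2)(|y|²+ε)^{-(k+1)}, hence at least the weight itself. Integration by parts and Young's
inequality then absorb half of the left side. For ε > 0 everything is bounded by integrable
functions, while the constant 4 does not involve ε. -/
theorem integral_sq_mul_regWeight_le {K : ℕ} (hKN : K ≤ N) {k : ℕ} (hk : 2 * k + 3 ≤ K) {ε : ℝ}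
    (hε : 0 < ε) {f : Space N → ℝ} (hf : ContDiff ℝ ∞ f) (hf2 : MemLp f 2 volume)
    (hdf : ∀ i, MemLp (partialDeriv i f) 2 volume) :
    ∫ x, f x ^ 2 * regWeight K ε x ^ (k + 1) ≤
      4 * ∑ i, ∫ x, partialDeriv i f x ^ 2 * regWeight K ε x ^ k := by
  classical
  set s : Finset (Fin N) := Finset.univ.filter fun i => i.val < K with hs
  have hcard : s.card = K := by
    rw [hs, Fin.card_filter_val_lt, min_eq_right hKN]
  have hmem : ∀ i ∈ s, i.val < K := fun i hi => by simpa [hs] using hi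
  set V : Fin N → Space N → ℝ := fun i x => x i * regWeight K ε x ^ (k + 1) with hV
  have hVc : ∀ i, ContDiff ℝ ∞ (V i) := fun i => contDiff_apply_mul_regWeight_pow K i hε k
  have hsq : Integrable fun x => f x ^ 2 := hf2.integrable_sq
  have hprod : ∀ i, Integrable fun x => f x * partialDeriv i f x := fun i =>
    hf2.integrable_mul (hdf i)
  have hdsq : ∀ x i, partialDeriv i (fun x => f x ^ 2) x = 2 * (f x * partialDeriv i f x) := by
    intro x i
    have hd := (hf.differentiable (by simp)) x
    rw [show (fun x => f x ^ 2) = fun x => f x * f x from funext fun x => sq (f x),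
      partialDeriv_mul hd hd]
    ring
  have hI1 : ∀ i ∈ s, Integrable fun x => f x ^ 2 * partialDeriv i (V i) x := fun i hi =>
    hsq.mul_bdd (c := (1 + 2 * (k + 1)) * ε⁻¹ ^ (k + 1))
      (continuous_partialDeriv (hVc i) i).aestronglyMeasurable
      (Eventually.of_forall (abs_partialDeriv_apply_mul_regWeight_pow_le (hmem i hi) hε k))
  have hI2 : ∀ i ∈ s, Integrable fun x => partialDeriv i (fun x => f x ^ 2) x * V i x := by
    intro i hi
    simp only [hdsq]
    exact ((hprod i).const_mul 2).mul_bdd (c := (1 + ε⁻¹) * ε⁻¹ ^ k)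
      (hVc i).continuous.aestronglyMeasurable
      (Eventually.of_forall (abs_apply_mul_regWeight_pow_le (hmem i hi) hε k))
  have hI3 : ∀ i ∈ s, Integrable fun x => f x ^ 2 * V i x := fun i hi =>
    hsq.mul_bdd (c := (1 + ε⁻¹) * ε⁻¹ ^ k)
      (hVc i).continuous.aestronglyMeasurable
      (Eventually.of_forall (abs_apply_mul_regWeight_pow_le (hmem i hi) hε k))
  have hparts : ∀ i ∈ s, ∫ x, f x ^ 2 * partialDeriv i (V i) x =
      ∫ x, -(partialDeriv i (fun x => f x ^ 2) x * V i x) := by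
    intro i hi
    rw [integral_neg]
    exact integral_mul_fderiv_eq_neg_fderiv_mul_of_integrable (hI2 i hi) (hI1 i hi) (hI3 i hi)
      (fun x _ => ((hf.pow 2).differentiable (by simp)) x)
      (fun x _ => ((hVc i).differentiable (by simp)) x)
  have hA := integrable_mul_regWeight_pow hsq K hε (k + 1)
  have hB : ∀ i, Integrable fun x => partialDeriv i f x ^ 2 * regWeight K ε x ^ k := fun i =>
    integrable_mul_regWeight_pow (hdf i).integrable_sq K hε k
  have hyint : Integrable fun x => ∑ i ∈ s, f x ^ 2 * partialDeriv i (V i) x :=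
    integrable_finsetSum _ hI1
  have hlow : ∫ x, f x ^ 2 * regWeight K ε x ^ (k + 1) ≤
      ∫ x, ∑ i ∈ s, f x ^ 2 * partialDeriv i (V i) x := by
    refine integral_mono hA hyint fun x => ?_
    simp only [hV]
    rw [← Finset.mul_sum, Finset.sum_congr rfl fun i hi =>
      partialDeriv_apply_mul_regWeight_pow (hmem i hi) hε k x]
    refine mul_le_mul_of_nonneg_left ?_ (sq_nonneg _)
    rw [Finset.sum_sub_distrib, Finset.sum_const, hcard, nsmul_eq_mul, ← Finset.mul_sum,
      ← Finset.sum_mul]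
    have h1 : ySq K x * regWeight K ε x ^ (k + 2) ≤ regWeight K ε x ^ (k + 1) := by
      rw [pow_succ', ← mul_assoc]
      exact mul_le_of_le_one_left (pow_pos (regWeight_pos K hε x) _).le
        (ySq_mul_regWeight_le K hε x)
    change _ ≤ _ - 2 * ((k : ℝ) + 1) * (ySq K x * regWeight K ε x ^ (k + 2))
    have h2 : (2 * k + 3 : ℝ) ≤ K := by exact_mod_cast hk
    have h3 := pow_pos (regWeight_pos K hε x) (k + 1)
    nlinarith [mul_le_mul_of_nonneg_left h1 (show (0 : ℝ) ≤ 2 * (k + 1) by positivity)]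
  have hup : ∫ x, ∑ i ∈ s, f x ^ 2 * partialDeriv i (V i) x ≤
      ∫ x, (1 / 2 * (f x ^ 2 * regWeight K ε x ^ (k + 1)) +
        2 * ∑ i, partialDeriv i f x ^ 2 * regWeight K ε x ^ k) := by
    rw [integral_finsetSum _ hI1, Finset.sum_congr rfl hparts,
      ← integral_finsetSum (f := fun i x => -(partialDeriv i (fun x => f x ^ 2) x * V i x)) s
        fun i hi => (hI2 i hi).neg]
    refine integral_mono (integrable_finsetSum _ fun i hi => (hI2 i hi).neg)
      ((hA.const_mul _).add ((integrable_finsetSum _ fun i _ => hB i).const_mul _)) fun x => ?_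
    have hw := regWeight_pos K hε x
    simp only [hdsq, hV]
    have h1 : ∀ i ∈ s, -(2 * (f x * partialDeriv i f x) * (x i * regWeight K ε x ^ (k + 1))) ≤
        1 / 2 * (f x ^ 2 * (x i ^ 2 * regWeight K ε x ^ (k + 2))) +
          2 * (partialDeriv i f x ^ 2 * regWeight K ε x ^ k) := by
      intro i _
      -- Young's inequality as a completed square; its coefficient 1/2 on the f² term is what allows
      -- the absorption.
      have := mul_nonneg (pow_pos hw k).le
        (sq_nonneg (f x * x i * regWeight K ε x + 2 * partialDeriv i f x))
      have e : regWeight K ε x ^ k * (f x * x i * regWeight K ε x + 2 * partialDeriv i f x) ^ 2 =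
        2 * (1 / 2 * (f x ^ 2 * (x i ^ 2 * regWeight K ε x ^ (k + 2))) +
          2 * (partialDeriv i f x ^ 2 * regWeight K ε x ^ k)) +
          2 * (2 * (f x * partialDeriv i f x) * (x i * regWeight K ε x ^ (k + 1))) := by ring
      linarith
    refine (Finset.sum_le_sum h1).trans ?_
    rw [Finset.sum_add_distrib, ← Finset.mul_sum, ← Finset.mul_sum, ← Finset.mul_sum,
      ← Finset.sum_mul]
    have h2 : (∑ i ∈ s, x i ^ 2) * regWeight K ε x ^ (k + 2) ≤ regWeight K ε x ^ (k + 1) := by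
      rw [pow_succ', ← mul_assoc]
      exact mul_le_of_le_one_left (pow_pos hw _).le (ySq_mul_regWeight_le K hε x)
    have h3 : ∑ i ∈ s, partialDeriv i f x ^ 2 * regWeight K ε x ^ k ≤
        ∑ i, partialDeriv i f x ^ 2 * regWeight K ε x ^ k :=
      Finset.sum_le_sum_of_subset_of_nonneg (Finset.subset_univ s) fun i _ _ => by positivity
    have h4 := mul_le_mul_of_nonneg_left h2 (sq_nonneg (f x))
    linarith
  rw [integral_add (hA.const_mul _) ((integrable_finsetSum _ fun i _ => hB i).const_mul _),
    integral_const_mul, integral_const_mul, integral_finsetSum _ fun i _ => hB i] at hup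
  linarith

/-- For fixed ε the weights are bounded, so the smooth inequality survives approximation in H¹.
Passing from u to f and back to the derivatives of u costs a factor 2 each time, turning 4 into 16.
-/
theorem MemH.integral_sq_mul_regWeight_le {K : ℕ} (hKN : K ≤ N) {k : ℕ} (hk : 2 * k + 3 ≤ K)
    {ε : ℝ} (hε : 0 < ε) {u : Space N → ℝ} (hu : MemH 1 u) :
    ∫ x, u x ^ 2 * regWeight K ε x ^ (k + 1) ≤
      16 * ∑ i, ∫ x, Polyharmonic.weakPartial i u x ^ 2 * regWeight K ε x ^ k := by
  have hd : ∀ i, MemLp (Polyharmonic.weakPartial i u) 2 volume := fun i =>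
    (hu.weakPartial (k := 0) i).memLp
  -- The total coefficient of the approximation errors: with accuracy δ / A they add up to exactly
  -- δ.
  set A := 2 * ε⁻¹ ^ (k + 1) + 16 * N * ε⁻¹ ^ k with hA
  have hA0 : 0 < A := by positivity
  have hcmp : ∀ {a b : Space N → ℝ}, MemLp a 2 volume → MemLp b 2 volume → ∀ j : ℕ,
      ∫ x, a x ^ 2 * regWeight K ε x ^ j ≤ 2 * (∫ x, b x ^ 2 * regWeight K ε x ^ j) +
        2 * (ε⁻¹ ^ j * ∫ x, (a x - b x) ^ 2) := by
    intro a b ha hb j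
    have h1 := integrable_mul_regWeight_pow ha.integrable_sq K hε j
    have h2 := integrable_mul_regWeight_pow hb.integrable_sq K hε j
    have h3 : Integrable fun x => (a x - b x) ^ 2 := (ha.sub hb).integrable_sq
    rw [← integral_const_mul, ← integral_const_mul, ← integral_const_mul,
      ← integral_add (h2.const_mul 2) ((h3.const_mul _).const_mul 2)]
    refine integral_mono h1 ((h2.const_mul 2).add ((h3.const_mul _).const_mul 2)) fun x => ?_
    have hw := pow_pos (regWeight_pos K hε x) j
    have hw2 := regWeight_pow_le K j hε x
    have h4 : a x ^ 2 ≤ 2 * b x ^ 2 + 2 * (a x - b x) ^ 2 := by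
      nlinarith [sq_nonneg (a x - 2 * b x)]
    have h5 := mul_le_mul_of_nonneg_right h4 hw.le
    have h6 := mul_le_mul_of_nonneg_right hw2 (sq_nonneg (a x - b x))
    change a x ^ 2 * regWeight K ε x ^ j ≤ 2 * (b x ^ 2 * regWeight K ε x ^ j) +
      2 * (ε⁻¹ ^ j * (a x - b x) ^ 2)
    linarith
  refine le_of_forall_pos_le_add fun δ hδ => ?_
  obtain ⟨f, hf, hf2, hdf, h1, h2⟩ := hu.exists_smooth_approx (δ := δ / A) (by positivity)
  have e1 := hcmp hu.memLp hf2 (k + 1)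
  have e2 := Polyharmonic.integral_sq_mul_regWeight_le hKN hk hε hf hf2 hdf
  have e3 : ∑ i, ∫ x, partialDeriv i f x ^ 2 * regWeight K ε x ^ k ≤
      ∑ i : Fin N, (2 * (∫ x, Polyharmonic.weakPartial i u x ^ 2 * regWeight K ε x ^ k) +
        2 * (ε⁻¹ ^ k * (δ / A))) := by
    refine Finset.sum_le_sum fun i _ => (hcmp (hdf i) (hd i) k).trans ?_
    have := h2 i
    gcongr
  rw [Finset.sum_add_distrib, ← Finset.mul_sum, Finset.sum_const, Finset.card_univ,
    Fintype.card_fin, nsmul_eq_mul] at e3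
  have e4 : ∫ x, (u x - f x) ^ 2 ≤ δ / A := by
    refine le_trans (le_of_eq ?_) h1
    congr 1; ext x; ring
  have e5 := mul_le_mul_of_nonneg_left e4 (show 0 ≤ ε⁻¹ ^ (k + 1) by positivity)
  have e6 : 2 * (ε⁻¹ ^ (k + 1) * (δ / A)) + 8 * (N * (2 * (ε⁻¹ ^ k * (δ / A)))) = δ := by
    have : 2 * (ε⁻¹ ^ (k + 1) * (δ / A)) + 8 * (N * (2 * (ε⁻¹ ^ k * (δ / A)))) =
      A * (δ / A) := by rw [hA]; ring
    rw [this, mul_div_cancel₀ _ hA0.ne']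
  linarith

/-- Each Hardy step trades one power of the weight for one derivative. The bound is uniform in ε,
ready for the limit ε → 0. -/
theorem MemH.exists_bound_integral_regWeight {K : ℕ} (hKN : K ≤ N) (k : ℕ) :
    2 * k < K → ∀ {u : Space N → ℝ}, MemH k u →
      ∃ C, ∀ ε > 0, ∫ x, u x ^ 2 * regWeight K ε x ^ k ≤ C := by
  induction k with
  | zero => exact fun _ u _ => ⟨∫ x, u x ^ 2, fun ε _ => by simp⟩
  | succ k ih =>
    intro hk u hu
    have h := fun i => ih (by omega) (hu.weakPartial i)
    choose C hC using h
    have hu1 : MemH 1 u := ⟨hu.memLp, fun i =>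
      ⟨_, hu.hasWeakPartial i, (hu.weakPartial i).memLp⟩⟩
    refine ⟨16 * ∑ i, C i, fun ε hε =>
      (hu1.integral_sq_mul_regWeight_le hKN (by omega) hε).trans ?_⟩
    gcongr with i _
    exact hC i ε hε

/-- Functions in `H^m` have finite weighted norm: a qualitative Hardy–Rellich inequality. -/
theorem MemH.integrable_hardy {K m : ℕ} (hKN : K ≤ N) (hK : 2 * m < K) {u : Space N → ℝ}
    (hu : MemH m u) : Integrable (fun x => (yNorm K x ^ (2 * m))⁻¹ * u x ^ 2) := by
  obtain ⟨C, hC⟩ := hu.exists_bound_integral_regWeight hKN m hK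
  have hmeasY : Measurable (fun x : Space N => (yNorm K x ^ (2 * m))⁻¹) := by
    simp only [yNorm_pow_two_mul]
    exact ((continuous_ySq K).pow m).measurable.inv
  refine ⟨hmeasY.aestronglyMeasurable.mul (hu.memLp.1.pow 2), ?_⟩
  have hnn : ∀ x, 0 ≤ (yNorm K x ^ (2 * m))⁻¹ * u x ^ 2 := fun x => by
    rw [yNorm_pow_two_mul]
    have := ySq_nonneg K x
    positivity
  rw [hasFiniteIntegral_iff_ofReal (Eventually.of_forall hnn)]
  let ε : ℕ → ℝ := fun n => 1 / ((n : ℝ) + 1)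
  have hε : ∀ n, 0 < ε n := fun n => by positivity
  have hlim : Tendsto ε atTop (𝓝 0) := tendsto_one_div_add_atTop_nhds_zero_nat
  have hF : ∀ n, AEMeasurable
      (fun x => ENNReal.ofReal (u x ^ 2 * regWeight K (ε n) x ^ m)) volume := fun n =>
    (integrable_mul_regWeight_pow hu.memLp.integrable_sq K (hε n) m).1.aemeasurable.ennreal_ofReal
  have hfatou := lintegral_liminf_le' (u := atTop) hF
  have hbd : ∀ n, ∫⁻ x, ENNReal.ofReal (u x ^ 2 * regWeight K (ε n) x ^ m) ≤ ENNReal.ofReal C := by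
    intro n
    rw [← ofReal_integral_eq_lintegral_ofReal
      (integrable_mul_regWeight_pow hu.memLp.integrable_sq K (hε n) m)
      (Eventually.of_forall fun x =>
        mul_nonneg (sq_nonneg _) (pow_pos (regWeight_pos K (hε n) x) m).le)]
    exact ENNReal.ofReal_le_ofReal (hC _ (hε n))
  refine lt_of_le_of_lt (le_trans (lintegral_mono fun x => ?_) (hfatou.trans
    (liminf_le_of_le (by isBoundedDefault) fun b hb => ?_))) (ENNReal.ofReal_lt_top (r := C))
  -- At y = 0 the unregularized weight is 0 by the convention for inverses when m > 0, and 1 when m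
  -- = 0; elsewhere the regularized weights converge to it. So the bound needed for Fatou holds at
  -- every point.
  · by_cases hx : ySq K x = 0
    · rcases Nat.eq_zero_or_pos m with rfl | hm
      · simp
      · rw [yNorm_pow_two_mul, hx, zero_pow hm.ne']
        simp
    · refine le_of_eq (Tendsto.liminf_eq ?_).symm
      refine ENNReal.tendsto_ofReal ?_
      rw [yNorm_pow_two_mul, mul_comm, ← inv_pow]
      refine Tendsto.const_mul _ (Tendsto.pow ?_ m)
      have : Tendsto (fun n => ySq K x + ε n) atTop (𝓝 (ySq K x)) := by
        simpa using hlim.const_add (ySq K x)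
      exact this.inv₀ hx
  · obtain ⟨n, hn⟩ := hb.exists
    exact hn.trans (hbd n)

end

section

variable {N : ℕ}

/-! ### Translations decrease the singular term -/

/-- The projection onto the first `K` coordinates. -/
def yProj {N K : ℕ} (hKN : K ≤ N) (x : Space N) : Space K :=
  WithLp.toLp 2 fun j => x (Fin.castLE hKN j)

/-- The inclusion of the first `K` coordinates, extending by zero. -/
def yIncl {N K : ℕ} (η : Space K) : Space N :=
  WithLp.toLp 2 fun i => if h : i.val < K then η ⟨i.val, h⟩ else 0

theorem yProj_sub_yIncl {K : ℕ} (hKN : K ≤ N) (x : Space N) (η : Space K) :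
    yProj hKN (x - yIncl η) = yProj hKN x - η := by
  ext j
  simp [yProj, yIncl]

theorem ySq_eq_norm_sq {K : ℕ} (hKN : K ≤ N) (x : Space N) : ySq K x = ‖yProj hKN x‖ ^ 2 := by
  rw [EuclideanSpace.real_norm_sq_eq, ySq]
  simp only [yProj]
  refine (Finset.sum_bij (fun (j : Fin K) _ => Fin.castLE hKN j) ?_ ?_ ?_ ?_).symm
  · simp
  · intro a _ b _ h
    exact Fin.castLE_injective hKN h
  · intro i hi
    exact ⟨⟨i.val, by simpa using hi⟩, Finset.mem_univ _, rfl⟩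
  · simp

theorem continuous_yIncl {K : ℕ} : Continuous (yIncl : Space K → Space N) := by
  unfold yIncl
  refine (PiLp.continuous_toLp 2 _).comp (continuous_pi fun i => ?_)
  split_ifs
  · fun_prop
  · exact continuous_const

theorem measurable_yNorm_pow_inv (K m : ℕ) :
    Measurable (fun x : Space N => (yNorm K x ^ (2 * m))⁻¹) := by
  simp only [yNorm_pow_two_mul]
  exact ((continuous_ySq K).pow m).measurable.inv

theorem yNorm_pow_inv_nonneg (K m : ℕ) (x : Space N) : 0 ≤ (yNorm K x ^ (2 * m))⁻¹ := by
  rw [yNorm_pow_two_mul]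
  have := ySq_nonneg K x
  positivity

theorem yNorm_pow_eq {K : ℕ} (hKN : K ≤ N) (m : ℕ) (x : Space N) :
    yNorm K x ^ (2 * m) = ‖yProj hKN x‖ ^ (2 * m) := by
  rw [yNorm_pow_two_mul, ySq_eq_norm_sq hKN, ← pow_mul]

/-- In polar coordinates the integrand is t^{K-1-2m}, with a nonnegative exponent because 2m < K. -/
theorem lintegral_ball_norm_pow_inv_lt_top {K m : ℕ} (hK : 2 * m < K) (r : ℝ) :
    ∫⁻ η in Metric.ball (0 : Space K) r, ENNReal.ofReal ((‖η‖ ^ (2 * m))⁻¹) < ⊤ := by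
  have : Nontrivial (Space K) := by
    have : Nonempty (Fin K) := ⟨⟨0, by omega⟩⟩
    infer_instance
  have h1 : Integrable (fun η : Space K =>
      (Set.Iio r).indicator (fun t : ℝ => (t ^ (2 * m))⁻¹) ‖η‖) := by
    rw [integrable_fun_norm_addHaar volume, finrank_euclideanSpace_fin]
    have h2 : IntegrableOn (fun t : ℝ => t ^ (K - 1 - 2 * m)) (Set.Ioo 0 r) :=
      ((continuous_pow _).integrableOn_Icc (a := 0) (b := r)).mono_set Set.Ioo_subset_Icc_self
    have h3 : (fun t : ℝ => t ^ (K - 1) • (Set.Iio r).indicator (fun t : ℝ => (t ^ (2 * m))⁻¹) t) =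
        (Set.Iio r).indicator fun t : ℝ => t ^ (K - 1) * (t ^ (2 * m))⁻¹ := by
      ext t
      by_cases h : t < r <;> simp [h]
    rw [h3, IntegrableOn, integrable_indicator_iff measurableSet_Iio, IntegrableOn,
      Measure.restrict_restrict measurableSet_Iio, Set.inter_comm, Set.Ioi_inter_Iio]
    refine IntegrableOn.congr_fun h2 (fun t ht => ?_) measurableSet_Ioo
    have ht0 : t ≠ 0 := ht.1.ne'
    change t ^ (K - 1 - 2 * m) = t ^ (K - 1) * (t ^ (2 * m))⁻¹
    rw [pow_sub₀ _ ht0 (by omega)]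
  rw [← lintegral_indicator measurableSet_ball]
  refine lt_of_le_of_lt (lintegral_mono fun η => ?_) h1.lintegral_lt_top
  by_cases h : ‖η‖ < r
  · rw [Set.indicator_of_mem (by simpa using h), Set.indicator_of_mem (by simpa using h)]
  · rw [Set.indicator_of_notMem (by simpa using h)]
    exact zero_le

/-- Split at distance r from y: the near part is a translate of a fixed integral, the far part is at
most r^{-2m}. The bound is uniform in y. -/
theorem setLIntegral_ball_norm_sub_pow_inv_le {K : ℕ} (m : ℕ) (y : Space K) {r : ℝ} (hr : 0 < r)
    (R : ℝ) :
    ∫⁻ η in Metric.ball (0 : Space K) R, ENNReal.ofReal ((‖y - η‖ ^ (2 * m))⁻¹) ≤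
      (∫⁻ η in Metric.ball (0 : Space K) r, ENNReal.ofReal ((‖η‖ ^ (2 * m))⁻¹)) +
        ENNReal.ofReal ((r ^ (2 * m))⁻¹) * volume (Metric.ball (0 : Space K) R) := by
  set F : Space K → ℝ≥0∞ := (Metric.ball (0 : Space K) r).indicator
    fun η => ENNReal.ofReal ((‖η‖ ^ (2 * m))⁻¹) with hF
  have hFm : Measurable F := by
    refine Measurable.indicator ?_ measurableSet_ball
    exact ((continuous_norm.pow _).measurable.inv).ennreal_ofReal
  have hle : ∀ η, ENNReal.ofReal ((‖y - η‖ ^ (2 * m))⁻¹) ≤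
      F (y - η) + ENNReal.ofReal ((r ^ (2 * m))⁻¹) := by
    intro η
    by_cases h : ‖y - η‖ < r
    · rw [hF, Set.indicator_of_mem (by simpa using h)]
      exact le_self_add
    · refine le_trans (ENNReal.ofReal_le_ofReal ?_) le_add_self
      exact inv_anti₀ (by positivity) (pow_le_pow_left₀ hr.le (not_lt.1 h) _)
  refine (lintegral_mono hle).trans ?_
  rw [lintegral_add_right _ measurable_const, setLIntegral_const]
  refine add_le_add ?_ le_rfl
  refine (setLIntegral_le_lintegral _ _).trans (le_of_eq ?_)
  rw [lintegral_sub_left_eq_self F y, hF, lintegral_indicator measurableSet_ball]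

/-- Tonelli and the uniform bound above. After division by |B_R| with R large, the average singular
term over all shifts in B_R is about r^{-2m} times the mass, and r is free. -/
theorem lintegral_translate_average_le {K m : ℕ} (hKN : K ≤ N) {u : Space N → ℝ}
    (hu : MemLp u 2 volume) {r : ℝ} (hr : 0 < r) (R : ℝ) :
    ∫⁻ η in Metric.ball (0 : Space K) R, ∫⁻ x : Space N,
        ENNReal.ofReal ((yNorm K (x - yIncl η) ^ (2 * m))⁻¹ * u x ^ 2) ≤
      ((∫⁻ η in Metric.ball (0 : Space K) r, ENNReal.ofReal ((‖η‖ ^ (2 * m))⁻¹)) +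
        ENNReal.ofReal ((r ^ (2 * m))⁻¹) * volume (Metric.ball (0 : Space K) R)) *
        ∫⁻ x, ENNReal.ofReal (u x ^ 2) := by
  have hmeas : AEMeasurable (Function.uncurry fun (η : Space K) (x : Space N) =>
      ENNReal.ofReal ((yNorm K (x - yIncl η) ^ (2 * m))⁻¹ * u x ^ 2))
      ((volume.restrict (Metric.ball 0 R)).prod volume) := by
    refine AEMeasurable.ennreal_ofReal (AEMeasurable.mul ?_ ?_)
    · refine Measurable.aemeasurable ((measurable_yNorm_pow_inv K m).comp
        (f := fun z : Space K × Space N => z.2 - yIncl z.1) ?_)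
      exact measurable_snd.sub (continuous_yIncl.measurable.comp measurable_fst)
    · exact (hu.1.aemeasurable.pow_const 2).comp_quasiMeasurePreserving
        Measure.quasiMeasurePreserving_snd
  rw [lintegral_lintegral_swap hmeas, ← lintegral_const_mul'' _
    (hu.1.aemeasurable.pow_const 2).ennreal_ofReal]
  refine lintegral_mono fun x => ?_
  have h1 : ∀ η : Space K, ENNReal.ofReal ((yNorm K (x - yIncl η) ^ (2 * m))⁻¹ * u x ^ 2) =
      ENNReal.ofReal ((‖yProj hKN x - η‖ ^ (2 * m))⁻¹) * ENNReal.ofReal (u x ^ 2) := fun η => by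
    rw [yNorm_pow_eq hKN, yProj_sub_yIncl, ENNReal.ofReal_mul (by positivity)]
  simp only [h1]
  rw [lintegral_mul_const' _ _ ENNReal.ofReal_ne_top]
  exact mul_le_mul' (setLIntegral_ball_norm_sub_pow_inv_le m _ hr R) le_rfl

/-- If no shift lowered the singular term, its average over shifts η in a ball of ℝ^K would be at
least B, which contradicts the averaged bound on a large ball. -/
theorem exists_translate_lt {K m : ℕ} (hm : 1 ≤ m) (hKN : K ≤ N) (hK : 2 * m < K)
    {u : Space N → ℝ} (hu : MemLp u 2 volume)
    (hpos : 0 < ∫ x, (yNorm K x ^ (2 * m))⁻¹ * u x ^ 2) :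
    ∃ τ : Space N, Integrable (fun x => (yNorm K x ^ (2 * m))⁻¹ * u (x + τ) ^ 2) ∧
      ∫ x, (yNorm K x ^ (2 * m))⁻¹ * u (x + τ) ^ 2 <
        ∫ x, (yNorm K x ^ (2 * m))⁻¹ * u x ^ 2 := by
  set B := ∫ x, (yNorm K x ^ (2 * m))⁻¹ * u x ^ 2 with hB
  have hnn : ∀ τ x, 0 ≤ (yNorm K x ^ (2 * m))⁻¹ * u (x + τ) ^ 2 := fun τ x =>
    mul_nonneg (yNorm_pow_inv_nonneg K m x) (sq_nonneg _)
  suffices h : ∃ τ : Space N,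
      ∫⁻ x, ENNReal.ofReal ((yNorm K x ^ (2 * m))⁻¹ * u (x + τ) ^ 2) < ENNReal.ofReal B by
    obtain ⟨τ, hτ⟩ := h
    have hi : Integrable (fun x => (yNorm K x ^ (2 * m))⁻¹ * u (x + τ) ^ 2) := by
      refine ⟨(measurable_yNorm_pow_inv K m).aestronglyMeasurable.mul
        ((hu.1.comp_quasiMeasurePreserving
          (measurePreserving_add_right volume τ).quasiMeasurePreserving).pow 2), ?_⟩
      rw [hasFiniteIntegral_iff_ofReal (Eventually.of_forall (hnn τ))]
      exact hτ.trans ENNReal.ofReal_lt_top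
    refine ⟨τ, hi, ?_⟩
    rw [← ofReal_integral_eq_lintegral_ofReal hi (Eventually.of_forall (hnn τ))] at hτ
    exact (ENNReal.ofReal_lt_ofReal_iff hpos).1 hτ
  by_contra! hcon
  set M := ∫ x, u x ^ 2 with hM
  have hM0 : 0 ≤ M := integral_nonneg fun x => sq_nonneg _
  -- Makes the far contribution r^{-2m}M at most B/2; the lower bound 1 gives r ≤ r^{2m}.
  set r := max 1 (2 * M / B) with hr
  have hr1 : 1 ≤ r := le_max_left _ _
  have hr0 : 0 < r := by linarith
  have hrm : M * (r ^ (2 * m))⁻¹ ≤ B / 2 := by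
    have h1 : r ≤ r ^ (2 * m) := le_self_pow₀ hr1 (by omega)
    have h2 : 2 * M / B ≤ r ^ (2 * m) := (le_max_right _ _).trans h1
    rw [← div_eq_mul_inv, div_le_iff₀ (by positivity)]
    rw [div_le_iff₀ hpos] at h2
    linarith
  set c := (∫⁻ η in Metric.ball (0 : Space K) r, ENNReal.ofReal ((‖η‖ ^ (2 * m))⁻¹)).toReal with hc
  have hc0 : 0 ≤ c := ENNReal.toReal_nonneg
  set V := (volume (Metric.ball (0 : Space K) 1)).toReal with hV
  have hV0 : 0 < V := ENNReal.toReal_pos (Metric.measure_ball_pos _ _ one_pos).ne'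
    measure_ball_lt_top.ne
  have key : ∀ R : ℝ, 0 < R → B * (R ^ K * V) ≤ (c + (r ^ (2 * m))⁻¹ * (R ^ K * V)) * M := by
    intro R hR
    have h1 := lintegral_translate_average_le (m := m) hKN hu hr0 R
    have hvol : volume (Metric.ball (0 : Space K) R) = ENNReal.ofReal (R ^ K * V) := by
      rw [Measure.addHaar_ball_of_pos _ _ hR, finrank_euclideanSpace_fin,
        ENNReal.ofReal_mul (by positivity), hV, ENNReal.ofReal_toReal measure_ball_lt_top.ne]
    have h2 : ENNReal.ofReal B * volume (Metric.ball (0 : Space K) R) ≤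
        ∫⁻ η in Metric.ball (0 : Space K) R, ∫⁻ x : Space N,
          ENNReal.ofReal ((yNorm K (x - yIncl η) ^ (2 * m))⁻¹ * u x ^ 2) := by
      rw [← setLIntegral_const]
      refine lintegral_mono fun η => (hcon (yIncl η)).trans (le_of_eq ?_)
      rw [← lintegral_add_right_eq_self (μ := volume) (fun x : Space N =>
        ENNReal.ofReal ((yNorm K (x - yIncl η) ^ (2 * m))⁻¹ * u x ^ 2)) (yIncl η)]
      simp
    have h3 := h2.trans h1
    rw [hvol, ← ENNReal.ofReal_toReal (lintegral_ball_norm_pow_inv_lt_top hK r).ne, ← hc,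
      ← ofReal_integral_eq_lintegral_ofReal hu.integrable_sq
        (Eventually.of_forall fun x => sq_nonneg _), ← hM, ← ENNReal.ofReal_mul (by positivity),
      ← ENNReal.ofReal_mul (by positivity), ← ENNReal.ofReal_add hc0 (by positivity),
      ← ENNReal.ofReal_mul (by positivity)] at h3
    exact (ENNReal.ofReal_le_ofReal_iff (by positivity)).1 h3
  -- Chosen so that R·BV exceeds 2cM: the near contribution is then below B/2 times the volume of
  -- the ball.
  set R := 2 * (c * M) / (B * V) + 1 with hR
  have hR1 : 1 ≤ R := by
    rw [hR]
    have : 0 ≤ 2 * (c * M) / (B * V) := by positivity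
    linarith
  have hRK : R ≤ R ^ K := le_self_pow₀ hR1 (by omega)
  have h4 := key R (by linarith)
  have h5 : R * (B * V) = 2 * (c * M) + B * V := by
    rw [hR]
    field_simp
  have h6 : 0 ≤ R ^ K * V := by positivity
  have h7 := mul_le_mul_of_nonneg_right hrm h6
  have h8 := mul_le_mul_of_nonneg_right hRK (show 0 ≤ B * V by positivity)
  have h9 : 0 < B * V := by positivity
  nlinarith

theorem volume_yNorm_eq_zero {K : ℕ} (hK : 0 < K) (hKN : K ≤ N) :
    volume {x : Space N | yNorm K x = 0} = 0 := by
  let i : Fin N := ⟨0, by omega⟩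
  let S : Submodule ℝ (Space N) := LinearMap.ker (EuclideanSpace.proj i : Space N →L[ℝ] ℝ).toLinearMap
  have hS : S ≠ ⊤ := by
    intro h
    have : EuclideanSpace.single i (1 : ℝ) ∈ S := h ▸ Submodule.mem_top
    simp [S] at this
  refine measure_mono_null (fun x hx => ?_) (Measure.addHaar_submodule volume S hS)
  have hx : yNorm K x = 0 := hx
  rw [yNorm, Real.sqrt_eq_zero (Finset.sum_nonneg fun _ _ => sq_nonneg _)] at hx
  have := (Finset.sum_eq_zero_iff_of_nonneg fun _ _ => sq_nonneg _).1 hx i (by simp [i, hK])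
  change x i = 0
  exact pow_eq_zero_iff (two_ne_zero) |>.1 this

/-- The weight vanishes by convention only on {y = 0}, which lies in a hyperplane and is null. -/
theorem integral_hardy_pos {K m : ℕ} (hK : 0 < K) (hKN : K ≤ N) {u : Space N → ℝ}
    (hint : Integrable (fun x => (yNorm K x ^ (2 * m))⁻¹ * u x ^ 2))
    (hu : ¬ u =ᵐ[volume] 0) : 0 < ∫ x, (yNorm K x ^ (2 * m))⁻¹ * u x ^ 2 := by
  have hnn : 0 ≤ fun x : Space N => (yNorm K x ^ (2 * m))⁻¹ * u x ^ 2 := fun x =>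
    mul_nonneg (yNorm_pow_inv_nonneg K m x) (sq_nonneg _)
  refine lt_of_le_of_ne (integral_nonneg hnn) fun h => hu ?_
  have h0 := (integral_eq_zero_iff_of_nonneg hnn hint).1 h.symm
  have hy : ∀ᵐ x : Space N, yNorm K x ≠ 0 := by
    rw [ae_iff]
    simpa using volume_yNorm_eq_zero hK hKN
  filter_upwards [h0, hy] with x hx hx2
  have hx : (yNorm K x ^ (2 * m))⁻¹ * u x ^ 2 = 0 := hx
  rcases mul_eq_zero.1 hx with h | h
  · exact absurd (inv_eq_zero.1 h) (pow_ne_zero _ hx2)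
  · exact pow_eq_zero_iff two_ne_zero |>.1 h

end

section

variable {N m : ℕ} {g : ℝ → ℝ}

/-! ### The nonlinearity -/

theorem Admissible.gfun_nonneg (hg : Admissible N m g) (hN : 0 < N) (hm : 1 ≤ m) (t : ℝ) :
    0 ≤ Gfun g t := by
  have hN' : (0 : ℝ) < N := by exact_mod_cast hN
  have hm' : (0 : ℝ) < m := by exact_mod_cast hm
  exact nonneg_of_mul_nonneg_right (hg.G_pos.1 t) (by positivity)

theorem Admissible.hfun_nonneg (hg : Admissible N m g) (t : ℝ) : 0 ≤ Hfun g t :=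
  (hg.G_pos.1 t).trans (hg.G_le_H t)

theorem Admissible.hasDerivAt_gfun (hg : Admissible N m g) (t : ℝ) :
    HasDerivAt (Gfun g) (g t) t :=
  intervalIntegral.integral_hasDerivAt_right (hg.cont.intervalIntegrable _ _)
    (hg.cont.stronglyMeasurableAtFilter _ _) hg.cont.continuousAt

theorem Admissible.continuous_gfun (hg : Admissible N m g) : Continuous (Gfun g) :=
  continuous_iff_continuousAt.2 fun t => (hg.hasDerivAt_gfun t).continuousAt

/-- Condition (A4) says precisely that r ↦ r^{-2_*}H(rt) is nondecreasing: its derivative is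
r^{-2_*-1}(h(rt)rt - 2_*H(rt)). -/
theorem Admissible.hfun_mul_le (hg : Admissible N m g) (t : ℝ) {r : ℝ} (hr : 0 < r)
    (hr1 : r ≤ 1) : Hfun g (r * t) ≤ r ^ massExp N m * Hfun g t := by
  set p := massExp N m with hp
  have hder : ∀ r : ℝ, 0 < r → HasDerivAt (fun r : ℝ => Hfun g (r * t) * r ^ (-p))
      (deriv (Hfun g) (r * t) * t * r ^ (-p) + Hfun g (r * t) * (-p * r ^ (-p - 1))) r := by
    intro r hr
    have h1 : HasDerivAt (fun r : ℝ => r * t) t r := by simpa using (hasDerivAt_id r).mul_const t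
    have h2 : HasDerivAt (fun r : ℝ => Hfun g (r * t)) (deriv (Hfun g) (r * t) * t) r :=
      HasDerivAt.comp (h₂ := Hfun g) (h := fun r : ℝ => r * t) r (hg.diff_H (r * t)).hasDerivAt h1
    exact h2.mul (Real.hasDerivAt_rpow_const (Or.inl hr.ne'))
  have hmono : MonotoneOn (fun r : ℝ => Hfun g (r * t) * r ^ (-p)) (Set.Ioi 0) := by
    refine monotoneOn_of_deriv_nonneg (convex_Ioi 0)
      (fun r hr => (hder r hr).continuousAt.continuousWithinAt)
      (fun r hr => (hder r (by simpa using hr)).differentiableAt.differentiableWithinAt)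
      fun r hr => ?_
    have hr0 : 0 < r := by simpa using hr
    rw [(hder r hr0).deriv]
    have h3 : r ^ (-p) = r * r ^ (-p - 1) := by
      rw [Real.rpow_sub_one hr0.ne']
      field_simp
    have h4 := hg.prec_h.1 (r * t)
    have h5 : 0 < r ^ (-p - 1) := Real.rpow_pos_of_pos hr0 _
    rw [h3]
    have : deriv (Hfun g) (r * t) * t * (r * r ^ (-p - 1)) +
        Hfun g (r * t) * (-p * r ^ (-p - 1)) =
        r ^ (-p - 1) * (deriv (Hfun g) (r * t) * (r * t) - p * Hfun g (r * t)) := by ring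
    rw [this]
    exact mul_nonneg h5.le (sub_nonneg.2 h4)
  have h := hmono (Set.mem_Ioi.2 hr) (Set.mem_Ioi.2 one_pos) hr1
  simp only [one_mul, Real.one_rpow, mul_one] at h
  rw [Real.rpow_neg hr.le, ← div_eq_mul_inv, div_le_iff₀ (Real.rpow_pos_of_pos hr _)] at h
  linarith

/-- The derivative of r^{-2}G(rt) is r^{-3}H(rt), which is at most r^{4m/N-1}H(t) by the
monotonicity of r^{-2_*}H(rt). Integrating from r to 1 gives the estimate, here phrased as the
monotonicity of a difference. -/
theorem Admissible.gfun_sub_le (hg : Admissible N m g) (hN : 0 < N) (hm : 1 ≤ m) (t : ℝ) {r : ℝ}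
    (hr : 0 < r) (hr1 : r ≤ 1) :
    Gfun g t - (r ^ 2)⁻¹ * Gfun g (r * t) ≤
      (N : ℝ) / (4 * m) * (1 - r ^ (4 * m / N : ℝ)) * Hfun g t := by
  have hN' : (0 : ℝ) < N := by exact_mod_cast hN
  have hm' : (0 : ℝ) < m := by exact_mod_cast hm
  set q : ℝ := 4 * m / N with hq
  have hq0 : 0 < q := by positivity
  have hder : ∀ r : ℝ, 0 < r → HasDerivAt
      (fun r : ℝ => Gfun g (r * t) * (r ^ 2)⁻¹ - Hfun g t / q * r ^ q)
      (g (r * t) * t * (r ^ 2)⁻¹ + Gfun g (r * t) * (-(2 * r) / (r ^ 2) ^ 2) -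
        Hfun g t / q * (q * r ^ (q - 1))) r := by
    intro r hr
    have h1 : HasDerivAt (fun r : ℝ => r * t) t r := by simpa using (hasDerivAt_id r).mul_const t
    have h2 : HasDerivAt (fun r : ℝ => Gfun g (r * t)) (g (r * t) * t) r :=
      HasDerivAt.comp (h₂ := Gfun g) (h := fun r : ℝ => r * t) r (hg.hasDerivAt_gfun (r * t)) h1
    have h3 : HasDerivAt (fun r : ℝ => (r ^ 2)⁻¹) (-(2 * r) / (r ^ 2) ^ 2) r := by
      have := (hasDerivAt_pow 2 r).fun_inv (by positivity)
      simpa using this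
    exact (h2.mul h3).sub ((Real.hasDerivAt_rpow_const (Or.inl hr.ne')).const_mul _)
  have hanti : AntitoneOn (fun r : ℝ => Gfun g (r * t) * (r ^ 2)⁻¹ - Hfun g t / q * r ^ q)
      (Set.Ioc 0 1) := by
    refine antitoneOn_of_deriv_nonpos (convex_Ioc 0 1)
      (fun r hr => (hder r hr.1).continuousAt.continuousWithinAt)
      (fun r hr => (hder r ?_).differentiableAt.differentiableWithinAt) fun r hr => ?_
    · rw [interior_Ioc] at hr
      exact hr.1
    · rw [interior_Ioc] at hr
      have hr0 : 0 < r := hr.1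
      rw [(hder r hr0).deriv]
      have h1 := hg.hfun_mul_le t hr0 hr.2.le
      have h2 : r ^ massExp N m = r ^ (q - 1) * r ^ 3 := by
        rw [massExp, ← hq, ← Real.rpow_natCast r 3, ← Real.rpow_add hr0]
        congr 1
        push_cast
        ring
      have h3 : g (r * t) * t * (r ^ 2)⁻¹ + Gfun g (r * t) * (-(2 * r) / (r ^ 2) ^ 2) -
          Hfun g t / q * (q * r ^ (q - 1)) =
          (r ^ 3)⁻¹ * (Hfun g (r * t) - r ^ massExp N m * Hfun g t) := by
        rw [h2]
        unfold Hfun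
        field_simp
        ring
      rw [h3]
      exact mul_nonpos_of_nonneg_of_nonpos (by positivity) (by linarith)
  have h := hanti ⟨hr, hr1⟩ ⟨one_pos, le_refl (1 : ℝ)⟩ hr1
  simp only [one_mul, Real.one_rpow, mul_one, one_pow, inv_one] at h
  have h4 : (N : ℝ) / (4 * m) = 1 / q := by rw [hq, one_div_div]
  rw [h4]
  have h5 : 1 / q * (1 - r ^ q) * Hfun g t = Hfun g t / q - Hfun g t / q * r ^ q := by ring
  rw [h5]
  linarith

theorem Admissible.eta_nonneg (hg : Admissible N m g) : 0 ≤ eta N m g := by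
  refine EReal.toReal_nonneg ?_
  refine le_limsup_of_frequently_le (Eventually.frequently (Eventually.of_forall fun s => ?_))
    (by isBoundedDefault)
  exact EReal.coe_nonneg.2 (div_nonneg (hg.hfun_nonneg s) (by positivity))

theorem Admissible.eventually_hfun_le (hg : Admissible N m g) {ε : ℝ} (hε : 0 < ε) :
    ∀ᶠ t in 𝓝 (0 : ℝ), Hfun g t ≤ (eta N m g + ε) * |t| ^ massExp N m := by
  have h1 : etaExt N m g < ((eta N m g + ε : ℝ) : EReal) :=
    lt_of_le_of_lt (EReal.le_coe_toReal hg.eta_lt_top.ne)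
      (EReal.coe_lt_coe_iff.2 (lt_add_of_pos_right _ hε))
  have h2 := eventually_lt_of_limsup_lt h1
  have h3 : ∀ᶠ t in 𝓝[≠] (0 : ℝ), Hfun g t ≤ (eta N m g + ε) * |t| ^ massExp N m := by
    filter_upwards [h2, self_mem_nhdsWithin] with t ht ht0
    have ht0 : 0 < |t| := abs_pos.2 ht0
    rw [EReal.coe_lt_coe_iff, div_lt_iff₀ (Real.rpow_pos_of_pos ht0 _)] at ht
    exact ht.le
  rw [eventually_nhdsWithin_iff] at h3
  filter_upwards [h3] with t ht
  by_cases h0 : t = 0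
  · subst h0
    simp [Hfun, Gfun, Real.zero_rpow (massExp_pos N m).ne']
  · exact ht h0

/-! ### Integrals of G and H along the amplitude scaling, and the return to the constraint. -/

section Fiber

variable {α : Type*} [MeasurableSpace α] {ν : Measure α} {u : α → ℝ}

theorem Admissible.scaled_hfun_le (hg : Admissible N m g) (t : ℝ) {r : ℝ} (hr : 0 < r)
    (hr1 : r ≤ 1) : (r ^ massExp N m)⁻¹ * Hfun g (r * t) ≤ Hfun g t := by
  rw [inv_mul_le_iff₀ (Real.rpow_pos_of_pos hr _)]
  exact hg.hfun_mul_le t hr hr1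

theorem Admissible.aestronglyMeasurable_hfun (hg : Admissible N m g)
    (hu : AEStronglyMeasurable u ν) (r : ℝ) :
    AEStronglyMeasurable (fun x => Hfun g (r * u x)) ν :=
  hg.diff_H.continuous.comp_aestronglyMeasurable (hu.const_mul r)

theorem Admissible.integrable_hfun_mul (hg : Admissible N m g) (hu : AEStronglyMeasurable u ν)
    (hH : Integrable (fun x => Hfun g (u x)) ν) {r : ℝ} (hr : 0 < r) (hr1 : r ≤ 1) :
    Integrable (fun x => Hfun g (r * u x)) ν := by
  refine (hH.const_mul (r ^ massExp N m)).mono (hg.aestronglyMeasurable_hfun hu r)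
    (Eventually.of_forall fun x => ?_)
  rw [Real.norm_of_nonneg (hg.hfun_nonneg _), Real.norm_of_nonneg
    (mul_nonneg (Real.rpow_nonneg hr.le _) (hg.hfun_nonneg _))]
  exact hg.hfun_mul_le _ hr hr1

theorem Admissible.integrable_gfun_mul (hg : Admissible N m g) (hN : 0 < N) (hm : 1 ≤ m)
    (hu : AEStronglyMeasurable u ν) (hH : Integrable (fun x => Hfun g (u x)) ν) {r : ℝ}
    (hr : 0 < r) (hr1 : r ≤ 1) : Integrable (fun x => Gfun g (r * u x)) ν := by
  have hN' : (0 : ℝ) < N := by exact_mod_cast hN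
  have hm' : (0 : ℝ) < m := by exact_mod_cast hm
  refine ((hg.integrable_hfun_mul hu hH hr hr1).const_mul ((4 * m / N : ℝ)⁻¹)).mono
    (hg.continuous_gfun.comp_aestronglyMeasurable (hu.const_mul r))
    (Eventually.of_forall fun x => ?_)
  rw [Real.norm_of_nonneg (hg.gfun_nonneg hN hm _), Real.norm_of_nonneg
    (mul_nonneg (by positivity) (hg.hfun_nonneg _)), le_inv_mul_iff₀ (by positivity)]
  exact hg.G_le_H _

/-- Since η is only a limsup, the scaled integrands need not converge. It suffices that their excess
over (η+ε)|u|^{2_*} is eventually zero at each point and dominated by H(u). -/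
theorem Admissible.exists_scaled_integral_lt (hg : Admissible N m g)
    (hu : AEStronglyMeasurable u ν) (hH : Integrable (fun x => Hfun g (u x)) ν)
    (hp : Integrable (fun x => |u x| ^ massExp N m) ν) {Q : ℝ}
    (hQ : eta N m g * ∫ x, |u x| ^ massExp N m ∂ν < Q) :
    ∃ r : ℝ, 0 < r ∧ r ≤ 1 ∧ (r ^ massExp N m)⁻¹ * ∫ x, Hfun g (r * u x) ∂ν < Q := by
  set I := ∫ x, |u x| ^ massExp N m ∂ν with hI
  have hI0 : 0 ≤ I := integral_nonneg fun x => by positivity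
  obtain ⟨ε, hε, hεQ⟩ : ∃ ε : ℝ, 0 < ε ∧ (eta N m g + ε) * I < Q := by
    -- This ε uses up at most half of the gap; I + 1 avoids dividing by zero.
    refine ⟨(Q - eta N m g * I) / (2 * (I + 1)), div_pos (by linarith) (by linarith), ?_⟩
    have h1 : (Q - eta N m g * I) / (2 * (I + 1)) * I ≤ (Q - eta N m g * I) / 2 := by
      rw [div_mul_eq_mul_div, div_le_div_iff₀ (by linarith) two_pos]
      nlinarith
    rw [add_mul]
    linarith
  have hη := hg.eta_nonneg
  let r : ℕ → ℝ := fun n => 1 / ((n : ℝ) + 1)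
  have hr : ∀ n, 0 < r n := fun n => by positivity
  have hr1 : ∀ n, r n ≤ 1 := fun n => by
    simp only [r]
    rw [div_le_one (by positivity)]
    linarith [n.cast_nonneg (α := ℝ)]
  have hlim : Tendsto r atTop (𝓝 0) := tendsto_one_div_add_atTop_nhds_zero_nat
  let D : ℕ → α → ℝ := fun n x => max ((r n ^ massExp N m)⁻¹ * Hfun g (r n * u x) -
    (eta N m g + ε) * |u x| ^ massExp N m) 0
  have hFint : ∀ n, Integrable (fun x => (r n ^ massExp N m)⁻¹ * Hfun g (r n * u x)) ν := fun n =>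
    (hg.integrable_hfun_mul hu hH (hr n) (hr1 n)).const_mul _
  have hDint : ∀ n, Integrable (D n) ν := fun n => ((hFint n).sub (hp.const_mul _)).pos_part
  have hD : Tendsto (fun n => ∫ x, D n x ∂ν) atTop (𝓝 0) := by
    rw [← integral_zero α ℝ (μ := ν)]
    refine tendsto_integral_of_dominated_convergence (fun x => Hfun g (u x))
      (fun n => (hDint n).1) hH (fun n => Eventually.of_forall fun x => ?_)
      (Eventually.of_forall fun x => ?_)
    · rw [Real.norm_of_nonneg (le_max_right _ _)]
      refine max_le ?_ (hg.hfun_nonneg _)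
      have h1 := hg.scaled_hfun_le (u x) (hr n) (hr1 n)
      have h2 : 0 ≤ (eta N m g + ε) * |u x| ^ massExp N m := by positivity
      linarith
    · have h1 : Tendsto (fun n => r n * u x) atTop (𝓝 0) := by simpa using hlim.mul_const (u x)
      refine tendsto_const_nhds.congr' ?_
      filter_upwards [h1.eventually (hg.eventually_hfun_le hε)] with n hn
      refine (max_eq_right ?_).symm
      rw [abs_mul, abs_of_pos (hr n), Real.mul_rpow (hr n).le (abs_nonneg _)] at hn
      have h2 : 0 < r n ^ massExp N m := Real.rpow_pos_of_pos (hr n) _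
      rw [sub_nonpos, inv_mul_le_iff₀ h2]
      linarith
  have hlt : ∀ᶠ n in atTop, ∫ x, D n x ∂ν < Q - (eta N m g + ε) * I :=
    hD.eventually_lt_const (by linarith)
  obtain ⟨n, hn⟩ := hlt.exists
  refine ⟨r n, hr n, hr1 n, ?_⟩
  have h3 : (r n ^ massExp N m)⁻¹ * ∫ x, Hfun g (r n * u x) ∂ν ≤
      ∫ x, (D n x + (eta N m g + ε) * |u x| ^ massExp N m) ∂ν := by
    rw [← integral_const_mul]
    refine integral_mono (hFint n) ((hDint n).add (hp.const_mul _)) fun x => ?_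
    have := le_max_left ((r n ^ massExp N m)⁻¹ * Hfun g (r n * u x) -
      (eta N m g + ε) * |u x| ^ massExp N m) 0
    change _ ≤ D n x + _
    linarith
  rw [integral_add (hDint n) (hp.const_mul _), integral_const_mul] at h3
  linarith

/-- Intermediate value theorem between a small amplitude and r = 1, with continuity from the
domination by H(u). -/
theorem Admissible.exists_scaled_integral_eq (hg : Admissible N m g)
    (hu : AEStronglyMeasurable u ν) (hH : Integrable (fun x => Hfun g (u x)) ν)
    (hp : Integrable (fun x => |u x| ^ massExp N m) ν) {Q : ℝ}
    (hQ : eta N m g * ∫ x, |u x| ^ massExp N m ∂ν < Q) (hQ' : Q < ∫ x, Hfun g (u x) ∂ν) :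
    ∃ r : ℝ, 0 < r ∧ r ≤ 1 ∧ (r ^ massExp N m)⁻¹ * ∫ x, Hfun g (r * u x) ∂ν = Q := by
  obtain ⟨r₀, h0, h1, hlt⟩ := hg.exists_scaled_integral_lt hu hH hp hQ
  have hcont : ContinuousOn (fun r : ℝ => ∫ x, (r ^ massExp N m)⁻¹ * Hfun g (r * u x) ∂ν)
      (Set.Icc r₀ 1) := by
    refine continuousOn_of_dominated (bound := fun x => Hfun g (u x))
      (fun r hr => (hg.aestronglyMeasurable_hfun hu r).const_mul _)
      (fun r hr => Eventually.of_forall fun x => ?_) hH (Eventually.of_forall fun x => ?_)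
    · have hr0 : 0 < r := h0.trans_le hr.1
      rw [Real.norm_of_nonneg (mul_nonneg (inv_nonneg.2 (Real.rpow_nonneg hr0.le _))
        (hg.hfun_nonneg _))]
      exact hg.scaled_hfun_le _ hr0 hr.2
    · refine ContinuousOn.mul (ContinuousOn.inv₀ ?_ fun r hr => ?_) ?_
      · exact continuousOn_id.rpow_const fun r hr => Or.inl (h0.trans_le hr.1).ne'
      · exact (Real.rpow_pos_of_pos (h0.trans_le hr.1) _).ne'
      · exact (hg.diff_H.continuous.comp (by fun_prop)).continuousOn
  have hmem : Q ∈ Set.Icc (∫ x, (r₀ ^ massExp N m)⁻¹ * Hfun g (r₀ * u x) ∂ν)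
      (∫ x, ((1 : ℝ) ^ massExp N m)⁻¹ * Hfun g (1 * u x) ∂ν) := by
    constructor
    · rw [integral_const_mul]
      exact hlt.le
    · simpa using hQ'.le
  obtain ⟨r, hr, hrQ⟩ := intermediate_value_Icc h1 hcont hmem
  refine ⟨r, h0.trans_le hr.1, hr.2, ?_⟩
  rw [← integral_const_mul]
  exact hrQ

end Fiber

end

section

variable {N K m : ℕ} {g : ℝ → ℝ} {u : Space N → ℝ} {μ ρ : ℝ}

/-! ### Lowering the energy by translation and dilation -/

/-- The split is legitimate only because the Hardy bound makes the singular part integrable. -/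
theorem MemH.singularForm_eq (hu : MemH m u) (hKN : K ≤ N) (hK : 2 * m < K) (μ : ℝ) :
    singularForm K m μ u =
      (∫ x, polyGradSq m u x) + μ * ∫ x, (yNorm K x ^ (2 * m))⁻¹ * u x ^ 2 := by
  rw [← integral_const_mul, ← integral_add hu.integrable_polyGradSq
    ((hu.integrable_hardy hKN hK).const_mul μ)]
  simp only [singularForm, div_eq_mul_inv, mul_assoc]

theorem yNorm_smul (K : ℕ) {s : ℝ} (hs : 0 ≤ s) (x : Space N) :
    yNorm K (s • x) = s * yNorm K x := by
  simp only [yNorm, PiLp.smul_apply, smul_eq_mul, mul_pow, ← Finset.mul_sum]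
  rw [Real.sqrt_mul (sq_nonneg s), Real.sqrt_sq hs]

/-- The weight is homogeneous of degree -2m, so this term scales exactly like the top-order one;
only the translation τ separates them. -/
theorem integral_hardy_dilate (K m : ℕ) (u : Space N → ℝ) (c : ℝ) {s : ℝ} (hs : 0 < s)
    (τ : Space N) :
    ∫ x, (yNorm K x ^ (2 * m))⁻¹ * dilate c s τ u x ^ 2 =
      c ^ 2 * s ^ (2 * m) * (s ^ N)⁻¹ * ∫ x, (yNorm K x ^ (2 * m))⁻¹ * u (x + τ) ^ 2 := by
  have h := integral_comp_dilate hs 0 fun x => (yNorm K x ^ (2 * m))⁻¹ * u (x + τ) ^ 2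
  rw [mul_assoc, ← h, ← integral_const_mul]
  congr 1 with x
  have hs' : s ^ (2 * m) ≠ 0 := by positivity
  rw [add_zero, yNorm_smul K hs.le, mul_pow, mul_inv, dilate]
  field_simp

theorem integral_sq_dilate (u : Space N → ℝ) (c : ℝ) {s : ℝ} (hs : 0 < s) (τ : Space N) :
    ∫ x, dilate c s τ u x ^ 2 = c ^ 2 * (s ^ N)⁻¹ * ∫ x, u x ^ 2 := by
  rw [mul_assoc, ← integral_comp_dilate hs τ fun x => u x ^ 2, ← integral_const_mul]
  simp only [dilate, mul_pow]

theorem integral_sq_pos_iff (hu : MemLp u 2 volume) :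
    0 < ∫ x, u x ^ 2 ↔ ¬ u =ᵐ[volume] 0 := by
  have hnn : 0 ≤ fun x => u x ^ 2 := fun x => sq_nonneg _
  rw [(integral_nonneg hnn).lt_iff_ne', Ne, integral_eq_zero_iff_of_nonneg hnn hu.integrable_sq]
  refine not_congr ⟨fun h => ?_, fun h => ?_⟩ <;> filter_upwards [h] with x hx
  · simpa using hx
  · simp [hx]

theorem integral_gfun_sub_le (hg : Admissible N m g) (hN : 0 < N) (hm : 1 ≤ m)
    (hu : AEStronglyMeasurable u volume) (hH : Integrable fun x => Hfun g (u x)) {r : ℝ}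
    (hr : 0 < r) (hr1 : r ≤ 1) :
    (∫ x, Gfun g (u x)) - (r ^ 2)⁻¹ * ∫ x, Gfun g (r * u x) ≤
      (N : ℝ) / (4 * m) * (1 - r ^ (4 * m / N : ℝ)) * ∫ x, Hfun g (u x) := by
  have hG : Integrable fun x => Gfun g (u x) := by
    simpa using hg.integrable_gfun_mul hN hm hu hH one_pos le_rfl
  have hGr := (hg.integrable_gfun_mul hN hm hu hH hr hr1).const_mul (r ^ 2)⁻¹
  rw [← integral_const_mul, ← integral_const_mul, ← integral_sub hG hGr]
  exact integral_mono (hG.sub hGr) (hH.const_mul _) fun x => hg.gfun_sub_le hN hm _ hr hr1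

/-- Every element of the constraint can be translated in the `y`-directions and then rescaled
back to the constraint in a mass preserving way, with a strictly smaller energy. -/
theorem exists_energy_lt (hm : 1 ≤ m) (hKN : K ≤ N) (hK : 2 * m < K) (hμ : 0 < μ)
    (hg : Admissible N m g)
    (hstrict : (N : ℝ) / (2 * m) * eta N m g * gnConst N m (massExp N m) ^ massExp N m
        * ρ ^ (2 * (m : ℝ) / N) < 1)
    (hu : u ∈ pohozaevSet N K m μ g) (hρ : ∫ x, u x ^ 2 ≤ ρ) :
    ∃ w ∈ pohozaevSet N K m μ g, ∫ x, w x ^ 2 = ∫ x, u x ^ 2 ∧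
      energy K m μ g w < energy K m μ g u := by
  obtain ⟨hmem, hne, hpoh⟩ := hu
  have hN : 0 < N := by omega
  have hN' : (0 : ℝ) < N := by exact_mod_cast hN
  have hm' : (0 : ℝ) < m := by exact_mod_cast hm
  have hmeas := hmem.memLp.1
  have hmass := (integral_sq_pos_iff hmem.memLp).2 hne
  set a := ∫ x, polyGradSq m u x with ha
  have ha0 : 0 ≤ a := integral_nonneg (polyGradSq_nonneg m u)
  set b := ∫ x, (yNorm K x ^ (2 * m))⁻¹ * u x ^ 2 with hb
  have hb0 : 0 < b := integral_hardy_pos (by omega) hKN (hmem.integrable_hardy hKN hK) hne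
  have hform : singularForm K m μ u = a + μ * b := hmem.singularForm_eq hKN hK μ
  have hHint : ∫ x, Hfun g (u x) = 2 * m / N * (a + μ * b) := by
    rw [← hform, hpoh]
    field_simp
  have hH : Integrable fun x => Hfun g (u x) := by
    -- A nonintegrable H(u) would have integral 0 by convention, but the constraint makes the
    -- integral positive.
    by_contra h
    rw [integral_undef h] at hHint
    have : 0 < 2 * m / N * (a + μ * b) := by positivity
    linarith
  obtain ⟨τ, hτint, hτ⟩ := exists_translate_lt hm hKN hK hmem.memLp hb0
  set b' := ∫ x, (yNorm K x ^ (2 * m))⁻¹ * u (x + τ) ^ 2 with hb'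
  have hb'0 : 0 < b' := by
    refine integral_hardy_pos (u := fun x => u (x + τ)) (by omega) hKN hτint ?_
    have h : MemLp (fun x => u (x + τ)) 2 volume := by
      have e : dilate 1 1 τ u = fun x => u (x + τ) := by
        ext x
        simp [dilate]
      exact e ▸ hmem.memLp.dilate 1 one_pos τ
    rw [← integral_sq_pos_iff h, integral_add_right_eq_self (μ := volume) (fun x => u x ^ 2) τ]
    exact hmass
  obtain ⟨hpint, hGN⟩ := hmem.gagliardoNirenberg hN hm
  have hη := hg.eta_nonneg
  have hC : 0 ≤ gnConst N m (massExp N m) ^ massExp N m :=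
    Real.rpow_nonneg (gnConst_spec hN hm).1 _
  -- Gagliardo–Nirenberg and the smallness condition give the bound (2m/N)a; the inequality becomes
  -- strict through μb' > 0.
  have hQ : eta N m g * ∫ x, |u x| ^ massExp N m < 2 * m / N * (a + μ * b') := by
    have h1 : (∫ x, u x ^ 2) ^ (2 * (m : ℝ) / N) ≤ ρ ^ (2 * (m : ℝ) / N) :=
      Real.rpow_le_rpow hmass.le hρ (by positivity)
    have h2 : eta N m g * ∫ x, |u x| ^ massExp N m ≤
        eta N m g * (gnConst N m (massExp N m) ^ massExp N m * a * ρ ^ (2 * (m : ℝ) / N)) := by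
      refine mul_le_mul_of_nonneg_left (hGN.trans ?_) hη
      gcongr
    have h3 : eta N m g * (gnConst N m (massExp N m) ^ massExp N m * a * ρ ^ (2 * (m : ℝ) / N)) =
        2 * m / N * a * ((N : ℝ) / (2 * m) * eta N m g * gnConst N m (massExp N m) ^ massExp N m
          * ρ ^ (2 * (m : ℝ) / N)) := by
      field_simp
    have h4 : 2 * m / N * a * ((N : ℝ) / (2 * m) * eta N m g *
        gnConst N m (massExp N m) ^ massExp N m * ρ ^ (2 * (m : ℝ) / N)) ≤ 2 * m / N * a :=
      mul_le_of_le_one_right (by positivity) hstrict.le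
    have h5 : 0 < 2 * m / N * (μ * b') := by positivity
    rw [mul_add]
    linarith
  have hQ' : 2 * m / N * (a + μ * b') < ∫ x, Hfun g (u x) := by
    rw [hHint]
    gcongr
  obtain ⟨r, hr, hr1, hrQ⟩ := hg.exists_scaled_integral_eq hmeas hH hpint hQ hQ'
  -- The relation s^N = r² preserves the mass and gives r^{2_*} = r² s^{2m}, which turns the
  -- equation for r into membership in the constraint.
  set s : ℝ := r ^ (2 / N : ℝ) with hs_def
  have hs : 0 < s := Real.rpow_pos_of_pos hr _
  have hsN : s ^ N = r ^ 2 := by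
    rw [hs_def, ← Real.rpow_mul_natCast hr.le, div_mul_cancel₀ _ hN'.ne']
    exact_mod_cast Real.rpow_natCast r 2
  have hsm : r ^ (4 * m / N : ℝ) = s ^ (2 * m) := by
    rw [hs_def, ← Real.rpow_mul_natCast hr.le]
    congr 1
    push_cast
    ring
  have hrp : r ^ massExp N m = r ^ 2 * s ^ (2 * m) := by
    rw [massExp, Real.rpow_add hr, hsm, Real.rpow_two]
  have hs0 : s ^ (2 * m) ≠ 0 := by positivity
  have hr0 : r ^ 2 ≠ 0 := by positivity
  have hHw : ∫ x, Hfun g (dilate r s τ u x) = s ^ (2 * m) * (2 * m / N * (a + μ * b')) := by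
    have h := integral_comp_dilate hs τ fun x => Hfun g (r * u x)
    simp only [dilate]
    rw [h, ← hrQ, hsN, hrp]
    field_simp
  have hGw : ∫ x, Gfun g (dilate r s τ u x) = (r ^ 2)⁻¹ * ∫ x, Gfun g (r * u x) := by
    rw [← hsN]
    exact integral_comp_dilate hs τ fun x => Gfun g (r * u x)
  have hmassw : ∫ x, dilate r s τ u x ^ 2 = ∫ x, u x ^ 2 := by
    rw [integral_sq_dilate u r hs, hsN, mul_inv_cancel₀ hr0, one_mul]
  have hmemw : MemH m (dilate r s τ u) := hmem.dilate r hs τ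
  have hformw : singularForm K m μ (dilate r s τ u) = s ^ (2 * m) * (a + μ * b') := by
    have h : r ^ 2 * s ^ (2 * m) * (r ^ 2)⁻¹ = s ^ (2 * m) := by field_simp
    rw [hmemw.singularForm_eq hKN hK, hmem.integral_polyGradSq_dilate r hs τ,
      integral_hardy_dilate K m u r hs τ, hsN, h]
    ring
  refine ⟨dilate r s τ u, ⟨hmemw, ?_, ?_⟩, hmassw, ?_⟩
  · rw [← integral_sq_pos_iff hmemw.memLp, hmassw]
    exact hmass
  · rw [hformw, hHw]
    field_simp
  · have h := integral_gfun_sub_le hg hN hm hmeas hH hr hr1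
    rw [hHint, hsm] at h
    have h1 : (N : ℝ) / (4 * m) * (1 - s ^ (2 * m)) * (2 * m / N * (a + μ * b)) =
        1 / 2 * (1 - s ^ (2 * m)) * (a + μ * b) := by
      field_simp
      ring
    rw [h1] at h
    -- The strict drop in energy comes only from b' < b; with b in place of b', the estimate `h`
    -- would give just a weak inequality.
    have h2 : s ^ (2 * m) * (a + μ * b') < s ^ (2 * m) * (a + μ * b) := by gcongr
    rw [energy, energy, hform, hformw, hGw]
    linarith

end

end Polyharmonic

end

theorem theorem3p4 (N K m : ℕ) (hm : 1 ≤ m) (hKN : K ≤ N) (hK : 2 * m < K)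
    (μ : ℝ) (hμ : 0 < μ) (ρ : ℝ) (hρ : 0 < ρ) (g : ℝ → ℝ)
    (hg : Polyharmonic.Admissible N m g)
    (hstrict : (N : ℝ) / (2 * m) * Polyharmonic.eta N m g
        * Polyharmonic.gnConst N m (Polyharmonic.massExp N m) ^ Polyharmonic.massExp N m
        * ρ ^ (2 * (m : ℝ) / N) < 1) :
    (¬ ∃ u, Polyharmonic.IsMinimizer (Polyharmonic.energy K m μ g)
        (Polyharmonic.pohozaevSet N K m μ g ∩ Polyharmonic.massBall N ρ) u) ∧
    (¬ ∃ u, Polyharmonic.IsMinimizer (Polyharmonic.energy K m μ g)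
        (Polyharmonic.pohozaevSet N K m μ g ∩ Polyharmonic.massSphere N ρ) u) ∧
    (¬ ∃ u : Polyharmonic.Space N → ℝ, Polyharmonic.IsNormalizedGroundState K m μ ρ g u) := by
  -- The competitor has exactly the mass of u, so the same argument works on the sphere and on the
  -- ball; a normalized ground state is in particular a minimizer on the sphere.
  have sphere : ¬ ∃ u, Polyharmonic.IsMinimizer (Polyharmonic.energy K m μ g)
      (Polyharmonic.pohozaevSet N K m μ g ∩ Polyharmonic.massSphere N ρ) u := by
    rintro ⟨u, ⟨hu, -, hmass⟩, hmin⟩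
    obtain ⟨w, hw, hmass', hlt⟩ :=
      Polyharmonic.exists_energy_lt hm hKN hK hμ hg hstrict hu hmass.le
    exact hlt.not_ge (hmin w ⟨hw, hw.1.memLp, hmass'.trans hmass⟩)
  refine ⟨?_, sphere, fun ⟨u, hu⟩ => sphere ⟨u, hu.2⟩⟩
  rintro ⟨u, ⟨hu, -, hmass⟩, hmin⟩
  obtain ⟨w, hw, hmass', hlt⟩ := Polyharmonic.exists_energy_lt hm hKN hK hμ hg hstrict hu hmass
  exact hlt.not_ge (hmin w ⟨hw, hw.1.memLp, hmass'.trans_le hmass⟩)
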